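/- **Theorem.** Let $q$ be a prime power. A *configuration* $(v_r,b_k)$, $r,k\ge 3$, is a finite incidence structure with $v$ points and $b$ lines, every point on exactly $r$ lines, every line containing exactly $k$ points, and at most one line through any two distinct points. Its *point graph* has the points as vertices, two distinct points being adjacent if they are collinear (lie on a common line). A *strongly regular configuration* $(v_k;\lambda,\mu)$ is a $(v_k,v_k)$ configuration whose point graph is strongly regular with parameters $(v,k(k-1),\lambda,\mu)$. A *semipartial geometry* with parameters $(s,t,\alpha,\mu)$ is a configuration with $r=t+1$, $k=s+1$ such that for every non-incident point-line pair $(x,\ell)$ the number of points on $\ell$ collinear with $x$ is $0$ or $\alpha$, and any two distinct non-collinear points have exactly $\mu$ points collinear with both. Let $LP(4,q)$ be the incidence structure whose points are the projective lines of $PG(4,q)$, whose lines are the projective planes of $PG(4,q)$, with inclusion as incidence. Let $(P_0,H_0)$ be a non-incident point-hyperplane pair of $PG(4,q)$, let $\pi$ be a polarity (inclusion-reversing involution) of the lattice of subspaces of $H_0$, and let $\pi'$ be a polarity of the lattice of subspaces through $P_0$. Such $P_0$ and $H_0$ exist, and every hyperplane $H_0$ and every point $P_0$ admit such polarities. Let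 * $LP(4,q)^{\pi}$ be obtained from $LP(4,q)$ by declaring, for projective lines $L$ and planes $p$ both contained in $H_0$, that $L$ is incident with $p$ if and only if $\pi(L)\subseteq p$; * $LP(4,q)_{\pi'}$ be obtained from $LP(4,q)$ by declaring, for projective lines $L$ and planes $p$ both containing $P_0$, that $L$ is incident with $p$ if and only if $L\subseteq\pi'(p)$; * $LP(4,q)^{\pi}_{\pi'}$ be obtained from $LP(4,q)$ by making both changes, all other incidences remaining unaltered. Then, for every choice of $P_0,H_0,\pi,\pi'$, the four incidence structures $LP(4,q)$, $LP(4,q)^{\pi}$, $LP(4,q)_{\pi'}$, $LP(4,q)^{\pi}_{\pi'}$ are pairwise non-isomorphic strongly regular $(v_k;\lambda,\mu)$ configurations with $$v=(q^2+1)(q^4+q^3+q^2+q+1),\quad k=q^2+q+1,\quad \lambda=q^3+2q^2+q-1,\quad \mu=(q+1)^2.$$ Moreover, $LP(4,q)$ is a semipartial geometry with parameters $s=t=q(q+1)$, $\alpha=q+1$, $\mu=(q+1)^2$, and the other three are not semipartial geometries for any parameters. -/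

import Mathlib

/-! An incidence structure with point type `P` and line type `L` is given by its incidence
relation `I : P → L → Prop`, where `I x l` means that the point `x` lies on the line `l`. -/

namespace SRConf

universe u v u' v'

section Incidence

variable {P : Type u} {L : Type v} {P' : Type u'} {L' : Type v'}

/-- Two incidence structures are isomorphic: there are bijections between the points and between
the lines that preserve incidence in both directions. -/
def Isomorphic (I : P → L → Prop) (J : P' → L' → Prop) : Prop :=
  ∃ (f : P ≃ P') (g : L ≃ L'), ∀ x l, I x l ↔ J (f x) (g l)

/-- The point graph: two distinct points are adjacent if they are collinear. -/
def pointGraph (I : P → L → Prop) : SimpleGraph P where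
  Adj x y := x ≠ y ∧ ∃ l, I x l ∧ I y l
  symm := ⟨fun _ _ h => ⟨h.1.symm, h.2.imp fun _ hl => ⟨hl.2, hl.1⟩⟩⟩
  loopless := ⟨fun _ h => h.1 rfl⟩

/-- A combinatorial `(v_r, b_k)` configuration: a finite partial linear space with `v` points, each
on exactly `r` lines, and `b` lines, each with exactly `k` points, where `r, k ≥ 3`. -/
structure IsConfiguration (I : P → L → Prop) (v r b k : ℕ) : Prop where
  finite_points : Finite P
  finite_lines : Finite L
  card_points : Nat.card P = v
  card_lines : Nat.card L = b
  point_degree : ∀ x, {l | I x l}.ncard = r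
  line_degree : ∀ l, {x | I x l}.ncard = k
  /-- at most one line passes through two distinct points -/
  partial_linear : ∀ x y l m, x ≠ y → I x l → I y l → I x m → I y m → l = m
  three_le_point_degree : 3 ≤ r
  three_le_line_degree : 3 ≤ k

/-- A strongly regular `(v_k; lam, mu)` configuration: a symmetric `(v_k)` configuration whose
point graph is strongly regular with parameters `(v, k (k - 1), lam, mu)`. -/
def IsStronglyRegularConfiguration (I : P → L → Prop) (v k lam mu : ℕ) : Prop :=
  IsConfiguration I v k v k ∧
    ∃ (_ : Fintype P) (_ : DecidableRel (pointGraph I).Adj),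
      (pointGraph I).IsSRGWith v (k * (k - 1)) lam mu

/-- A semipartial geometry with parameters `(s, t, α, μ)`: a configuration with point degree
`t + 1` and line degree `s + 1` such that for every non-incident point-line pair `(x, l)` there are
either `0` or `α` points on `l` collinear with `x`, and for every pair of distinct non-collinear
points there are exactly `μ` points collinear with both. -/
structure IsSemipartialGeometry (I : P → L → Prop) (s t α μ : ℕ) : Prop where
  configuration : ∃ v b, IsConfiguration I v (t + 1) b (s + 1)
  zero_or_alpha : ∀ x l, ¬ I x l →
    {y | I y l ∧ (pointGraph I).Adj x y}.ncard = 0 ∨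
    {y | I y l ∧ (pointGraph I).Adj x y}.ncard = α
  mu_eq : ∀ x y, x ≠ y → ¬ (pointGraph I).Adj x y →
    {z | (pointGraph I).Adj x z ∧ (pointGraph I).Adj y z}.ncard = μ

end Incidence

/-- A polarity: an inclusion-reversing involution. -/
structure Polarity (α : Type u) [LE α] where
  toFun : α → α
  involutive : Function.Involutive toFun
  inclusion_reversing : ∀ x y, x ≤ y → toFun y ≤ toFun x

section Projective

/-! Subspaces of the projective space of `V` are the linear subspaces of `V`: projective points,
lines, planes and solids are the subspaces of linear dimension `1`, `2`, `3` and `4`. -/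

variable (K : Type u) [Field K] (V : Type v) [AddCommGroup V] [Module K V]

/-- The projective lines. -/
abbrev ProjLine : Type v := {ℓ : Submodule K V // Module.finrank K ℓ = 2}

/-- The projective planes contained in the projective space. -/
abbrev ProjPlane : Type v := {p : Submodule K V // Module.finrank K p = 3}

/-- The incidence structure whose points are the projective lines, whose lines are the projective
planes, and whose incidence is inclusion. For `V` of dimension `n + 1` over the field with `q`
elements this is `LP(n,q)`. -/
def LP (ℓ : ProjLine K V) (p : ProjPlane K V) : Prop := ℓ.1 ≤ p.1

variable {K V}

open Classical in
/-- The transformation by a polarity `π` of the subspace `H₀` (whose subspaces form the lattice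
`Set.Iic H₀`): if both `ℓ` and `p` are contained in `H₀`, they become incident exactly when
`π(ℓ) ⊆ p`; all other incidences are unaltered. -/
def hyperplaneTransform (H₀ : Submodule K V) (π : Polarity (Set.Iic H₀))
    (I : ProjLine K V → ProjPlane K V → Prop) (ℓ : ProjLine K V) (p : ProjPlane K V) : Prop :=
  if h : ℓ.1 ≤ H₀ ∧ p.1 ≤ H₀ then (π.toFun ⟨ℓ.1, h.1⟩ : Submodule K V) ≤ p.1 else I ℓ p

open Classical in
/-- The dual transformation by a polarity `π'` of the quotient geometry at `P₀` (whose subspaces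
are those through `P₀`, the lattice `Set.Ici P₀`): if both `ℓ` and `p` contain `P₀`, they become
incident exactly when `ℓ ⊆ π'(p)`; all other incidences are unaltered. -/
def pointTransform (P₀ : Submodule K V) (π' : Polarity (Set.Ici P₀))
    (I : ProjLine K V → ProjPlane K V → Prop) (ℓ : ProjLine K V) (p : ProjPlane K V) : Prop :=
  if h : P₀ ≤ ℓ.1 ∧ P₀ ≤ p.1 then ℓ.1 ≤ (π'.toFun ⟨p.1, h.2⟩ : Submodule K V) else I ℓ p

/-- The four incidence structures `LP`, `LP^π`, `LP_π'` and `LP^π_π'`. -/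
def fourStructures (H₀ P₀ : Submodule K V) (π : Polarity (Set.Iic H₀))
    (π' : Polarity (Set.Ici P₀)) : Fin 4 → ProjLine K V → ProjPlane K V → Prop :=
  ![LP K V, hyperplaneTransform H₀ π (LP K V), pointTransform P₀ π' (LP K V),
    pointTransform P₀ π' (hyperplaneTransform H₀ π (LP K V))]

end Projective

end SRConf

open Module

namespace SRConf

/-! Two points of LP(4,q) are collinear exactly when, as lines of PG(4,q), they meet: meeting lines
span a plane. Two meeting lines have as common neighbours the other lines through their common point
or in their plane, and two skew lines have the (q+1)^2 transversals; this gives λ and μ.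

The change by π gives each plane p of H the lines of H through its pole π(p). Lines of H meet iff
they have a common point, hence iff they share such a star, so the point graph is unchanged
(`pointGraph_hyperplaneTransform`). The change by π' does alter the graph: a line x through P
becomes adjacent to the lines off P lying in the solid π'(x). Equivalently, a line y off P becomes
adjacent to the lines through P in π'(y+P), instead of those in y+P. The numbers of common
neighbours survive, since a polarity preserves the dimension of the intersection of two planes
through P (`ncard_lines_inf_app`); pairs with a line through P are counted directly. No subspace
through P lies in H, so the two changes do not interfere, and only two point graphs occur among the
four structures.

To tell the structures apart, call a non-incident pair (x,l) exceptional if the number of points on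
l collinear with x is neither 0 nor q+1. LP has none. After π they are the pairs with x not in H and
l in H; after π' those with x through P and l missing P; after both changes, pairs of both kinds
occur. Their counts are 1 or q^2+q+1, and both values occur, so no single α fits. Three isomorphism
invariants finish: whether exceptional pairs exist, whether an exceptional point lies on an
exceptional line (only after both changes), and whether two exceptional points can be non-collinear
(after π, but not after π'). -/

theorem ncard_eq_mul_of_fiber {α β : Type*} {s : Set α} {t : Set β} (hs : s.Finite)
    (ht : t.Finite) (f : α → β) (hf : Set.MapsTo f s t) (c : ℕ)
    (h : ∀ b ∈ t, {a | a ∈ s ∧ f a = b}.ncard = c) : s.ncard = t.ncard * c := by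
  classical
  lift s to Finset α using hs
  lift t to Finset β using ht
  rw [Set.ncard_coe_finset, Set.ncard_coe_finset, Finset.card_eq_sum_card_fiberwise hf]
  rw [Finset.sum_const_nat (m := c)]
  intro b hb
  rw [← h b hb, ← Set.ncard_coe_finset]
  congr 1
  ext a
  simp

/-- A bijection between two sets given by mutually inverse maps. -/
theorem ncard_eq_of_inverse {α β : Type*} {s : Set α} {t : Set β} (f : α → β) (g : β → α)
    (hf : ∀ a ∈ s, f a ∈ t ∧ g (f a) = a) (hg : ∀ b ∈ t, g b ∈ s ∧ f (g b) = b) :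
    s.ncard = t.ncard := by
  refine Set.ncard_congr (fun a _ => f a) (fun a ha => (hf a ha).1) ?_ ?_
  · intro a b ha hb hab
    rw [← (hf a ha).2, ← (hf b hb).2]
    exact congrArg g hab
  · intro b hb
    exact ⟨g b, (hg b hb).1, (hg b hb).2⟩

/-! ### Dimension arguments for subspaces -/

section Subspaces

variable {K : Type*} [Field K] {V : Type*} [AddCommGroup V] [Module K V] [FiniteDimensional K V]

theorem exists_between_finrank {A B : Submodule K V} (h : A ≤ B) {n : ℕ}
    (hn : finrank K A ≤ n) (hn' : n ≤ finrank K B) :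
    ∃ X, A ≤ X ∧ X ≤ B ∧ finrank K X = n := by
  induction n, hn using Nat.le_induction with
  | base => exact ⟨A, le_rfl, h, rfl⟩
  | succ n hn ih =>
    obtain ⟨X, hAX, hXB, hX⟩ := ih (by omega)
    have hlt : X < B := lt_of_le_of_ne hXB (by rintro rfl; omega)
    obtain ⟨v, hvB, hvX⟩ := SetLike.exists_of_lt hlt
    refine ⟨X ⊔ K ∙ v, hAX.trans le_sup_left,
      sup_le hXB (by simpa [Submodule.span_singleton_le_iff_mem] using hvB), ?_⟩
    rw [Submodule.finrank_sup_span_singleton hvX, hX]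

omit [FiniteDimensional K V] in
theorem exists_notMem_of_ne_top {X Y : Submodule K V} (hX : X ≠ ⊤) (hY : Y ≠ ⊤) :
    ∃ v, v ∉ X ∧ v ∉ Y := by
  obtain ⟨x, hx⟩ : ∃ x, x ∉ X := by
    by_contra! h; exact hX (Submodule.eq_top_iff'.2 h)
  obtain ⟨y, hy⟩ : ∃ y, y ∉ Y := by
    by_contra! h; exact hY (Submodule.eq_top_iff'.2 h)
  by_cases hxY : x ∈ Y
  · by_cases hyX : y ∈ X
    -- The sum of a vector only in Y and a vector only in X lies in neither.
    · exact ⟨x + y, fun h => hx ((X.add_mem_iff_left hyX).1 h),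
        fun h => hy ((Y.add_mem_iff_right hxY).1 h)⟩
    · exact ⟨y, hyX, hy⟩
  · exact ⟨x, hx, hxY⟩

omit [FiniteDimensional K V] in
theorem ne_top_of_finrank_lt {X : Submodule K V} (h : finrank K X < finrank K V) : X ≠ ⊤ := by
  rintro rfl
  simp at h

theorem eq_of_le_of_finrank {X Y : Submodule K V} (h : X ≤ Y) (hd : finrank K X = finrank K Y) :
    X = Y := Submodule.eq_of_le_of_finrank_eq h hd

theorem finrank_le_of_le {X Y : Submodule K V} (h : X ≤ Y) : finrank K X ≤ finrank K Y :=
  Submodule.finrank_mono h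

theorem finrank_lt_of_le_of_not_le {X Y : Submodule K V} (h : X ≤ Y) (h' : ¬ Y ≤ X) :
    finrank K X < finrank K Y :=
  Submodule.finrank_lt_finrank_of_lt (lt_of_le_not_ge h h')

theorem finrank_sup_add_inf (X Y : Submodule K V) :
    finrank K ↑(X ⊔ Y) + finrank K ↑(X ⊓ Y) = finrank K X + finrank K Y :=
  Submodule.finrank_sup_add_finrank_inf_eq X Y

theorem ne_bot_iff_finrank {X : Submodule K V} : X ≠ ⊥ ↔ 1 ≤ finrank K X := by
  rw [Nat.one_le_iff_ne_zero, Ne, Ne, Submodule.finrank_eq_zero]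

theorem le_of_finrank_one {P X : Submodule K V} (hP : finrank K P = 1) (h : P ⊓ X ≠ ⊥) :
    P ≤ X := by
  rw [ne_bot_iff_finrank] at h
  have := finrank_le_of_le (inf_le_left : P ⊓ X ≤ P)
  exact inf_eq_left.1 (eq_of_le_of_finrank inf_le_left (by omega))

/-! ### Polarities of intervals of subspaces -/

section Polarity

variable {s : Set (Submodule K V)} (π : Polarity s)

open Classical in
/-- A polarity of a set of subspaces as a map on all subspaces (the identity off the set). -/
noncomputable def Polarity.app (X : Submodule K V) : Submodule K V :=
  if h : X ∈ s then (π.toFun ⟨X, h⟩ : Submodule K V) else X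

variable {X Y : Submodule K V}

omit [FiniteDimensional K V] in
theorem Polarity.app_of_mem (h : X ∈ s) : π.app X = (π.toFun ⟨X, h⟩ : Submodule K V) := dif_pos h

omit [FiniteDimensional K V] in
theorem Polarity.app_mem (h : X ∈ s) : π.app X ∈ s := by
  rw [π.app_of_mem h]; exact Subtype.property _

omit [FiniteDimensional K V] in
theorem Polarity.app_app (h : X ∈ s) : π.app (π.app X) = X := by
  rw [π.app_of_mem (π.app_mem h)]
  have : (⟨π.app X, π.app_mem h⟩ : s) = π.toFun ⟨X, h⟩ := Subtype.ext (π.app_of_mem h)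
  rw [this, π.involutive]

omit [FiniteDimensional K V] in
theorem Polarity.app_le_app (hX : X ∈ s) (hY : Y ∈ s) (h : X ≤ Y) : π.app Y ≤ π.app X := by
  rw [π.app_of_mem hX, π.app_of_mem hY]
  exact π.inclusion_reversing _ _ h

omit [FiniteDimensional K V] in
theorem Polarity.app_le_iff (hX : X ∈ s) (hY : Y ∈ s) : π.app X ≤ Y ↔ π.app Y ≤ X := by
  refine ⟨fun h => ?_, fun h => ?_⟩
  · simpa [π.app_app hX] using π.app_le_app (π.app_mem hX) hY h
  · simpa [π.app_app hY] using π.app_le_app (π.app_mem hY) hX h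

omit [FiniteDimensional K V] in
theorem Polarity.le_app_iff (hX : X ∈ s) (hY : Y ∈ s) : X ≤ π.app Y ↔ Y ≤ π.app X := by
  refine ⟨fun h => ?_, fun h => ?_⟩
  · simpa [π.app_app hY] using π.app_le_app hX (π.app_mem hY) h
  · simpa [π.app_app hX] using π.app_le_app hY (π.app_mem hX) h

omit [FiniteDimensional K V] in
theorem Polarity.app_injOn (hX : X ∈ s) (hY : Y ∈ s) (h : π.app X = π.app Y) : X = Y := by
  rw [← π.app_app hX, h, π.app_app hY]

/-- Only order reversal is available, not linearity. Along a chain of unit steps from X up to B the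
images shrink strictly, which bounds the dimension of the image of X from below; a chain from X down
to A bounds it from above by the same number. -/
theorem Polarity.finrank_app_add {A B : Submodule K V} (hs : ∀ X, X ∈ s ↔ A ≤ X ∧ X ≤ B)
    (hX : X ∈ s) : finrank K (π.app X) + finrank K X = finrank K A + finrank K B := by
  have lower : ∀ m X, X ∈ s → finrank K X + m = finrank K B →
      finrank K A + m ≤ finrank K (π.app X) := by
    intro m
    induction m with
    | zero => exact fun X hX _ => finrank_le_of_le ((hs _).1 (π.app_mem hX)).1
    | succ m ih =>
      intro X hX hm
      obtain ⟨Y, hXY, hYB, hY⟩ := exists_between_finrank ((hs X).1 hX).2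
        (n := finrank K X + 1) (by omega) (by omega)
      have hYs : Y ∈ s := (hs Y).2 ⟨((hs X).1 hX).1.trans hXY, hYB⟩
      have h1 := ih Y hYs (by omega)
      have h2 : finrank K (π.app Y) < finrank K (π.app X) := by
        refine Submodule.finrank_lt_finrank_of_lt (lt_of_le_of_ne (π.app_le_app hX hYs hXY) ?_)
        intro h
        have := π.app_injOn hYs hX h
        subst this
        omega
      omega
  have upper : ∀ m X, X ∈ s → finrank K X = finrank K A + m →
      finrank K (π.app X) + m ≤ finrank K B := by
    intro m
    induction m with
    | zero => exact fun X hX _ => finrank_le_of_le ((hs _).1 (π.app_mem hX)).2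
    | succ m ih =>
      intro X hX hm
      obtain ⟨Y, hAY, hYX, hY⟩ := exists_between_finrank ((hs X).1 hX).1
        (n := finrank K A + m) (by omega) (by omega)
      have hYs : Y ∈ s := (hs Y).2 ⟨hAY, hYX.trans ((hs X).1 hX).2⟩
      have h1 := ih Y hYs (by omega)
      have h2 : finrank K (π.app X) < finrank K (π.app Y) := by
        refine Submodule.finrank_lt_finrank_of_lt (lt_of_le_of_ne (π.app_le_app hYs hX hYX) ?_)
        intro h
        have := π.app_injOn hX hYs h
        subst this
        omega
      omega
  have hA := finrank_le_of_le ((hs X).1 hX).1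
  have hB := finrank_le_of_le ((hs X).1 hX).2
  have h1 := lower (finrank K B - finrank K X) X hX (by omega)
  have h2 := upper (finrank K X - finrank K A) X hX (by omega)
  omega

theorem Polarity.finrank_app_Iic {B : Submodule K V} (π : Polarity (Set.Iic B)) (h : X ≤ B) :
    finrank K (π.app X) + finrank K X = finrank K B := by
  simpa using π.finrank_app_add (A := ⊥) (B := B) (by simp) h

theorem Polarity.finrank_app_Ici {A : Submodule K V} (π : Polarity (Set.Ici A)) (h : A ≤ X) :
    finrank K (π.app X) + finrank K X = finrank K A + finrank K V := by
  simpa using π.finrank_app_add (A := A) (B := ⊤) (by simp) h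

end Polarity

/-- The orthogonal complement for the standard dot product in a basis is an involution because the
form is symmetric and nondegenerate; isotropic vectors do no harm. -/
theorem nonempty_polarity_submodule : Nonempty (Polarity (Submodule K V)) := by
  classical
  let b := Module.finBasis K V
  let B := Matrix.toBilin b (1 : Matrix (Fin (finrank K V)) (Fin (finrank K V)) K)
  have hnd : B.Nondegenerate := by
    refine Matrix.Nondegenerate.toBilin ?_ b
    exact Matrix.nondegenerate_of_det_ne_zero (by simp)
  have hsymm : B.IsSymm := by
    refine ⟨fun x y => ?_⟩
    simp [B, Matrix.toBilin_apply, Matrix.one_apply, mul_comm]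
  exact ⟨{ toFun := fun W => B.orthogonal W
           involutive := fun W => LinearMap.BilinForm.orthogonal_orthogonal hnd hsymm.isRefl W
           inclusion_reversing := fun W U h => LinearMap.BilinForm.orthogonal_le h }⟩

theorem Polarity.nonempty_of_orderIso {α β : Type*} [LE α] [LE β] (e : α ≃o β)
    (h : Nonempty (Polarity α)) : Nonempty (Polarity β) := by
  obtain ⟨π⟩ := h
  exact ⟨{ toFun := fun x => e (π.toFun (e.symm x))
           involutive := fun x => by simp [π.involutive _]
           inclusion_reversing := fun x y h => by
             simpa using π.inclusion_reversing _ _ (e.symm.le_iff_le.2 h) }⟩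

theorem nonempty_polarity_Iic (B : Submodule K V) : Nonempty (Polarity (Set.Iic B)) :=
  Polarity.nonempty_of_orderIso (Submodule.mapIic B) nonempty_polarity_submodule

theorem nonempty_polarity_Ici (A : Submodule K V) : Nonempty (Polarity (Set.Ici A)) :=
  Polarity.nonempty_of_orderIso (Submodule.comapMkQRelIso A) nonempty_polarity_submodule

/-! ### Gaussian counts, lines and planes of PG(4,q) -/

section Counting

variable [Finite K]

instance finite_submodule : Finite (Submodule K V) := by
  have : Finite V := Module.finite_of_finite K
  exact Finite.of_injective (fun X : Submodule K V => (X : Set V)) SetLike.coe_injective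

omit [Finite K] in
theorem ncard_submodule (X : Submodule K V) : (X : Set V).ncard = Nat.card K ^ finrank K X := by
  rw [← Module.natCard_eq_pow_finrank (K := K) (V := X)]
  exact (Nat.card_coe_set_eq _).symm

/-- The number of subspaces of `B` that contain `A` with codimension one. -/
theorem ncard_between_succ {A B : Submodule K V} (hAB : A ≤ B) {n : ℕ}
    (hn : finrank K B = finrank K A + n) :
    {X : Submodule K V | finrank K X = finrank K A + 1 ∧ A ≤ X ∧ X ≤ B}.ncard =
      ∑ i ∈ Finset.range n, Nat.card K ^ i := by
  have : Finite V := Module.finite_of_finite K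
  have hq : 1 < Nat.card K := Finite.one_lt_card
  have hdiff : ∀ X : Submodule K V, A ≤ X →
      ((X : Set V) \ A).ncard = Nat.card K ^ finrank K X - Nat.card K ^ finrank K A := by
    intro X hX
    rw [Set.ncard_sdiff hX, ncard_submodule, ncard_submodule]
  -- Vectors v of B outside A are sorted by A + ⟨v⟩; each X arises from the q^(a+1) - q^a vectors of
  -- X outside A, where a = dim A.
  have key := ncard_eq_mul_of_fiber (s := (B : Set V) \ A)
    (t := {X : Submodule K V | finrank K X = finrank K A + 1 ∧ A ≤ X ∧ X ≤ B})
    (Set.toFinite _) (Set.toFinite _) (fun v => A ⊔ K ∙ v) ?_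
    (Nat.card K ^ (finrank K A + 1) - Nat.card K ^ finrank K A) ?_
  · rw [hdiff B hAB, hn] at key
    set N := Set.ncard _
    have hg := Nat.geomSum_eq (m := Nat.card K) (by omega) n
    rw [hg]
    symm
    apply Nat.div_eq_of_eq_mul_left (by omega)
    have hpos : 0 < Nat.card K ^ finrank K A := by positivity
    apply Nat.eq_of_mul_eq_mul_left hpos
    have e1 : Nat.card K ^ finrank K A * (Nat.card K ^ n - 1) =
        Nat.card K ^ (finrank K A + n) - Nat.card K ^ finrank K A := by
      rw [Nat.mul_sub, pow_add, mul_one]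
    have e2 : Nat.card K ^ finrank K A * (Nat.card K - 1) =
        Nat.card K ^ (finrank K A + 1) - Nat.card K ^ finrank K A := by
      rw [Nat.mul_sub, pow_succ, mul_one]
    rw [e1, key, ← e2]
    ring
  · rintro v ⟨hvB, hvA⟩
    exact ⟨Submodule.finrank_sup_span_singleton hvA, le_sup_left,
      sup_le hAB (by simpa [Submodule.span_singleton_le_iff_mem] using hvB)⟩
  · rintro X ⟨hXd, hAX, hXB⟩
    rw [← hXd, ← hdiff X hAX]
    congr 1
    ext v
    constructor
    · rintro ⟨⟨hvB, hvA⟩, rfl⟩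
      exact ⟨Submodule.mem_sup_right (Submodule.mem_span_singleton_self v), hvA⟩
    · rintro ⟨hvX, hvA⟩
      refine ⟨⟨hXB hvX, hvA⟩, eq_of_le_of_finrank (sup_le hAX ?_) ?_⟩
      · simpa [Submodule.span_singleton_le_iff_mem] using hvX
      · rw [Submodule.finrank_sup_span_singleton hvA, hXd]

/-- The number of hyperplanes of `B` that contain `A`. -/
theorem ncard_between_pred {A B : Submodule K V} (hAB : A ≤ B) {n : ℕ}
    (hn : finrank K B = finrank K A + n) :
    {X : Submodule K V | finrank K X + 1 = finrank K B ∧ A ≤ X ∧ X ≤ B}.ncard =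
      ∑ i ∈ Finset.range n, Nat.card K ^ i := by
  -- A polarity of B exchanges the hyperplanes of B containing A with the points of π(A).
  obtain ⟨π⟩ := nonempty_polarity_Iic B
  have hA := π.finrank_app_Iic hAB
  have hmem : ∀ X ≤ B, π.app X ≤ B := fun X hX => π.app_mem hX
  have hbot : π.app B = ⊥ := by
    have := π.finrank_app_Iic (le_refl B)
    exact Submodule.finrank_eq_zero.1 (by omega)
  have := ncard_between_succ (A := ⊥) (B := π.app A) bot_le (n := n) (by simp; omega)
  rw [← this]
  refine ncard_eq_of_inverse π.app π.app ?_ ?_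
  · rintro X ⟨hX, hAX, hXB⟩
    have := π.finrank_app_Iic hXB
    exact ⟨⟨by simp; omega, bot_le, π.app_le_app hAB hXB hAX⟩, π.app_app hXB⟩
  · rintro X ⟨hX, -, hXA⟩
    have hXB : X ≤ B := hXA.trans (hmem A hAB)
    have := π.finrank_app_Iic hXB
    simp only [finrank_bot] at hX
    exact ⟨⟨by omega, (π.le_app_iff hXB hAB).1 hXA, hmem X hXB⟩, π.app_app hXB⟩

/-- Incident point-line pairs are counted twice: each line has q+1 points, and each of the
q^4+q^3+q^2+q+1 points is on q^3+q^2+q+1 = (q+1)(q^2+1) lines. -/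
theorem ncard_lines (hV : finrank K V = 5) :
    {X : Submodule K V | finrank K X = 2}.ncard =
      (Nat.card K ^ 2 + 1) *
        (Nat.card K ^ 4 + Nat.card K ^ 3 + Nat.card K ^ 2 + Nat.card K + 1) := by
  have h1 := ncard_eq_mul_of_fiber
    (s := {F : Submodule K V × Submodule K V | finrank K F.1 = 1 ∧ finrank K F.2 = 2 ∧ F.1 ≤ F.2})
    (t := {X : Submodule K V | finrank K X = 2}) (Set.toFinite _) (Set.toFinite _) Prod.snd
    (fun F hF => hF.2.1) (Nat.card K + 1) ?_
  · have h2 := ncard_eq_mul_of_fiber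
      (s := {F : Submodule K V × Submodule K V |
        finrank K F.1 = 1 ∧ finrank K F.2 = 2 ∧ F.1 ≤ F.2})
      (t := {X : Submodule K V | finrank K X = 1}) (Set.toFinite _) (Set.toFinite _) Prod.fst
      (fun F hF => hF.1) (Nat.card K ^ 3 + Nat.card K ^ 2 + Nat.card K + 1) ?_
    · have h3 := ncard_between_succ (A := (⊥ : Submodule K V)) (B := ⊤) bot_le (n := 5) (by simp [hV])
      simp only [finrank_bot, zero_add, bot_le, le_top, and_self, and_true,
        Finset.sum_range_succ, Finset.sum_range_zero, pow_zero, pow_one] at h3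
      rw [h3, h1] at h2
      apply Nat.eq_of_mul_eq_mul_right (Nat.succ_pos (Nat.card K))
      rw [Nat.succ_eq_add_one, h2]
      ring
    · intro P hP
      replace hP : finrank K P = 1 := hP
      have h3 := ncard_between_succ (A := P) (B := ⊤) le_top (n := 4)
        (by rw [hP]; simp [hV])
      simp only [hP, Finset.sum_range_succ, Finset.sum_range_zero, pow_zero,
        pow_one, zero_add, le_top, and_true] at h3
      rw [show Nat.card K ^ 3 + Nat.card K ^ 2 + Nat.card K + 1 =
        1 + Nat.card K + Nat.card K ^ 2 + Nat.card K ^ 3 by ring, ← h3]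
      refine ncard_eq_of_inverse Prod.snd (fun X => (P, X)) ?_ ?_
      · rintro ⟨A, B⟩ ⟨⟨h, h', h''⟩, rfl⟩
        exact ⟨⟨h', h''⟩, rfl⟩
      · rintro X ⟨h, h'⟩
        exact ⟨⟨⟨hP, h, h'⟩, rfl⟩, rfl⟩
  · intro L hL
    replace hL : finrank K L = 2 := hL
    have h3 := ncard_between_succ (A := ⊥) (B := L) bot_le (n := 2)
      (by rw [hL]; simp)
    simp only [finrank_bot, Finset.sum_range_succ, Finset.sum_range_zero, pow_zero,
      pow_one, zero_add, bot_le, true_and] at h3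
    rw [add_comm, ← h3]
    refine ncard_eq_of_inverse Prod.fst (fun X => (X, L)) ?_ ?_
    · rintro ⟨A, B⟩ ⟨⟨h, h', h''⟩, rfl⟩
      exact ⟨⟨h, h''⟩, rfl⟩
    · rintro X ⟨h, h'⟩
      exact ⟨⟨⟨h, hL, h'⟩, rfl⟩, rfl⟩

/-- A polarity of the whole space exchanges lines and planes. -/
theorem ncard_planes (hV : finrank K V = 5) :
    {X : Submodule K V | finrank K X = 3}.ncard =
      (Nat.card K ^ 2 + 1) *
        (Nat.card K ^ 4 + Nat.card K ^ 3 + Nat.card K ^ 2 + Nat.card K + 1) := by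
  rw [← ncard_lines hV]
  obtain ⟨π⟩ := nonempty_polarity_Iic (⊤ : Submodule K V)
  have hd : ∀ X, finrank K (π.app X) + finrank K X = 5 := fun X => by
    simpa [hV] using π.finrank_app_Iic (le_top : X ≤ ⊤)
  refine ncard_eq_of_inverse π.app π.app ?_ ?_ <;>
  · intro X hX
    have := hd X
    simp only [Set.mem_ofPred_eq] at *
    exact ⟨by omega, π.app_app (Set.mem_Iic.2 le_top)⟩

end Counting

end Subspaces

/-! ### Counts for points and lines of the incidence structures -/

section Counting

variable {K : Type*} [Field K] {V : Type*} [AddCommGroup V] [Module K V] [FiniteDimensional K V]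

omit [FiniteDimensional K V] in
theorem ncard_subtype_finrank (d : ℕ) (Q : Submodule K V → Prop) :
    {x : {X : Submodule K V // finrank K X = d} | Q x.1}.ncard =
      {X : Submodule K V | finrank K X = d ∧ Q X}.ncard := by
  rw [← Set.ncard_image_of_injective _ Subtype.val_injective]
  congr 1
  ext X
  simp [and_comm]

variable [Finite K] {A B : Submodule K V} {d : ℕ}

theorem ncard_between_of_add_one (hAB : A ≤ B) {n : ℕ} (hd : finrank K A + 1 = d)
    (hn : finrank K B = finrank K A + n) :
    {x : {X : Submodule K V // finrank K X = d} | A ≤ x.1 ∧ x.1 ≤ B}.ncard =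
      ∑ i ∈ Finset.range n, Nat.card K ^ i := by
  rw [ncard_subtype_finrank d (fun X => A ≤ X ∧ X ≤ B), ← ncard_between_succ hAB hn, hd]

theorem ncard_between_one (hAB : A ≤ B) (hd : finrank K A + 1 = d)
    (hn : finrank K B = finrank K A + 1) :
    {x : {X : Submodule K V // finrank K X = d} | A ≤ x.1 ∧ x.1 ≤ B}.ncard = 1 := by
  rw [ncard_between_of_add_one hAB hd hn]
  simp

theorem ncard_between_two (hAB : A ≤ B) (hd : finrank K A + 1 = d)
    (hn : finrank K B = finrank K A + 2) :
    {x : {X : Submodule K V // finrank K X = d} | A ≤ x.1 ∧ x.1 ≤ B}.ncard = Nat.card K + 1 := by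
  rw [ncard_between_of_add_one hAB hd hn]
  simp [Finset.sum_range_succ]
  ring

theorem ncard_between_three (hAB : A ≤ B) (hd : finrank K A + 1 = d)
    (hn : finrank K B = finrank K A + 3) :
    {x : {X : Submodule K V // finrank K X = d} | A ≤ x.1 ∧ x.1 ≤ B}.ncard =
      Nat.card K ^ 2 + Nat.card K + 1 := by
  rw [ncard_between_of_add_one hAB hd hn]
  simp [Finset.sum_range_succ]
  ring

theorem ncard_between_four (hAB : A ≤ B) (hd : finrank K A + 1 = d)
    (hn : finrank K B = finrank K A + 4) :
    {x : {X : Submodule K V // finrank K X = d} | A ≤ x.1 ∧ x.1 ≤ B}.ncard =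
      Nat.card K ^ 3 + Nat.card K ^ 2 + Nat.card K + 1 := by
  rw [ncard_between_of_add_one hAB hd hn]
  simp [Finset.sum_range_succ]
  ring

theorem ncard_between_three' (hAB : A ≤ B) (hd : d + 1 = finrank K B)
    (hn : finrank K B = finrank K A + 3) :
    {x : {X : Submodule K V // finrank K X = d} | A ≤ x.1 ∧ x.1 ≤ B}.ncard =
      Nat.card K ^ 2 + Nat.card K + 1 := by
  have h := ncard_between_pred hAB hn
  rw [ncard_subtype_finrank d (fun X => A ≤ X ∧ X ≤ B)]
  simp only [← hd, add_left_inj] at h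
  rw [h]
  simp [Finset.sum_range_succ]
  ring

theorem ncard_lines_le {p : Submodule K V} (hp : finrank K p = 3) :
    {x : ProjLine K V | x.1 ≤ p}.ncard = Nat.card K ^ 2 + Nat.card K + 1 := by
  simpa using ncard_between_three' (A := ⊥) (B := p) (d := 2) bot_le (by omega) (by simp [hp])

end Counting

/-! ### Incidence after each transformation -/

section Transforms

variable {K : Type*} [Field K] {V : Type*} [AddCommGroup V] [Module K V]
  {H P : Submodule K V} {π : Polarity (Set.Iic H)} {π' : Polarity (Set.Ici P)}
  {I : ProjLine K V → ProjPlane K V → Prop} {x : ProjLine K V} {l : ProjPlane K V}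

/-- Involutivity moves π from the line to the plane, so that a plane of H carries the lines of H
through its pole. -/
theorem hyperplaneTransform_of_le (hx : x.1 ≤ H) (hl : l.1 ≤ H) :
    hyperplaneTransform H π I x l ↔ π.app l.1 ≤ x.1 := by
  rw [hyperplaneTransform, dif_pos ⟨hx, hl⟩, ← π.app_of_mem (Set.mem_Iic.2 hx)]
  exact π.app_le_iff hx hl

theorem hyperplaneTransform_of_not (h : ¬ (x.1 ≤ H ∧ l.1 ≤ H)) :
    hyperplaneTransform H π I x l ↔ I x l := by
  rw [hyperplaneTransform, dif_neg h]

theorem pointTransform_of_le (hx : P ≤ x.1) (hl : P ≤ l.1) :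
    pointTransform P π' I x l ↔ x.1 ≤ π'.app l.1 := by
  rw [pointTransform, dif_pos ⟨hx, hl⟩, ← π'.app_of_mem (Set.mem_Ici.2 hl)]

theorem pointTransform_of_not (h : ¬ (P ≤ x.1 ∧ P ≤ l.1)) :
    pointTransform P π' I x l ↔ I x l := by
  rw [pointTransform, dif_neg h]

theorem hyperplaneTransform_LP_of_not_le_point (hx : ¬ x.1 ≤ H) :
    hyperplaneTransform H π (LP K V) x l ↔ x.1 ≤ l.1 :=
  hyperplaneTransform_of_not (fun h => hx h.1)

theorem hyperplaneTransform_LP_of_not_le_line (hl : ¬ l.1 ≤ H) :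
    hyperplaneTransform H π (LP K V) x l ↔ x.1 ≤ l.1 :=
  hyperplaneTransform_of_not (fun h => hl h.2)

theorem hyperplaneTransform_LP_of_line_le (hl : l.1 ≤ H) :
    hyperplaneTransform H π (LP K V) x l ↔ π.app l.1 ≤ x.1 ∧ x.1 ≤ H := by
  by_cases hx : x.1 ≤ H
  · simp [hyperplaneTransform_of_le hx hl, hx]
  · rw [hyperplaneTransform_LP_of_not_le_point hx]
    exact ⟨fun h => (hx (h.trans hl)).elim, fun h => (hx h.2).elim⟩

theorem hyperplaneTransform_LP_of_point_le (hx : x.1 ≤ H) :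
    hyperplaneTransform H π (LP K V) x l ↔
      (π.app x.1 ≤ l.1 ∧ l.1 ≤ H) ∨ (x.1 ≤ l.1 ∧ ¬ l.1 ≤ H) := by
  by_cases hl : l.1 ≤ H
  · simp [hyperplaneTransform_of_le hx hl, hl, π.app_le_iff (Set.mem_Iic.2 hl) (Set.mem_Iic.2 hx)]
  · simp [hyperplaneTransform_LP_of_not_le_line hl, hl]

theorem pointTransform_LP_of_not_le_point (hx : ¬ P ≤ x.1) :
    pointTransform P π' (LP K V) x l ↔ x.1 ≤ l.1 :=
  pointTransform_of_not (fun h => hx h.1)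

theorem pointTransform_LP_of_not_le_line (hl : ¬ P ≤ l.1) :
    pointTransform P π' (LP K V) x l ↔ x.1 ≤ l.1 :=
  pointTransform_of_not (fun h => hl h.2)

/-- A plane missing P contains no line through P, so the unaltered incidences contribute nothing
here. -/
theorem pointTransform_LP_of_le_point (hx : P ≤ x.1) :
    pointTransform P π' (LP K V) x l ↔ P ≤ l.1 ∧ l.1 ≤ π'.app x.1 := by
  by_cases hl : P ≤ l.1
  · simp [pointTransform_of_le hx hl, hl, π'.le_app_iff (Set.mem_Ici.2 hx) (Set.mem_Ici.2 hl)]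
  · rw [pointTransform_LP_of_not_le_line hl]
    exact ⟨fun h => (hl (hx.trans h)).elim, fun h => (hl h.1).elim⟩

theorem pointTransform_LP_of_le_line (hl : P ≤ l.1) :
    pointTransform P π' (LP K V) x l ↔
      (P ≤ x.1 ∧ x.1 ≤ π'.app l.1) ∨ (¬ P ≤ x.1 ∧ x.1 ≤ l.1) := by
  by_cases hx : P ≤ x.1
  · simp [pointTransform_of_le hx hl, hx]
  · simp [pointTransform_LP_of_not_le_point hx, hx]

variable (hPH : ¬ P ≤ H)
include hPH

/-- Nothing through P lies in H, so incidences of a line through P are never affected by π. -/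
theorem both_transforms_of_le_point (hx : P ≤ x.1) :
    pointTransform P π' (hyperplaneTransform H π I) x l ↔ pointTransform P π' I x l := by
  by_cases hl : P ≤ l.1
  · rw [pointTransform_of_le hx hl, pointTransform_of_le hx hl]
  · rw [pointTransform_of_not (fun h => hl h.2), pointTransform_of_not (fun h => hl h.2),
      hyperplaneTransform_of_not (fun h => hPH (hx.trans h.1))]

theorem both_transforms_of_le_line (hl : P ≤ l.1) :
    pointTransform P π' (hyperplaneTransform H π I) x l ↔ pointTransform P π' I x l := by
  by_cases hx : P ≤ x.1
  · exact both_transforms_of_le_point hPH hx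
  · rw [pointTransform_of_not (fun h => hx h.1), pointTransform_of_not (fun h => hx h.1),
      hyperplaneTransform_of_not (fun h => hPH (hl.trans h.2))]

end Transforms

/-! ### The four structures are configurations -/

section Configurations

variable {K : Type*} [Field K] {V : Type*} [AddCommGroup V] [Module K V]
  {H P : Submodule K V} {π : Polarity (Set.Iic H)} {π' : Polarity (Set.Ici P)}

theorem both_transforms_of_not_le_point {I : ProjLine K V → ProjPlane K V → Prop}
    {x : ProjLine K V} {l : ProjPlane K V} (hx : ¬ P ≤ x.1) :
    pointTransform P π' (hyperplaneTransform H π I) x l ↔ hyperplaneTransform H π I x l :=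
  pointTransform_of_not (fun h => hx h.1)

theorem both_transforms_of_not_le_line {I : ProjLine K V → ProjPlane K V → Prop}
    {x : ProjLine K V} {l : ProjPlane K V} (hl : ¬ P ≤ l.1) :
    pointTransform P π' (hyperplaneTransform H π I) x l ↔ hyperplaneTransform H π I x l :=
  pointTransform_of_not (fun h => hl h.2)

variable (H P) in
/-- A non-incident point-hyperplane pair of a projective space of dimension four. -/
structure IsAntiflag : Prop where
  finrank_space : finrank K V = 5
  finrank_hyperplane : finrank K H = 4
  finrank_point : finrank K P = 1
  not_le : ¬ P ≤ H

variable [FiniteDimensional K V]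

theorem eq_sup_of_le {x y l : Submodule K V} (hx : finrank K x = 2) (hy : finrank K y = 2)
    (hl : finrank K l = 3) (hxy : x ≠ y) (hxl : x ≤ l) (hyl : y ≤ l) : x ⊔ y = l := by
  refine eq_of_le_of_finrank (sup_le hxl hyl) ?_
  have h1 := finrank_le_of_le (sup_le hxl hyl)
  have h2 : finrank K x < finrank K ↑(x ⊔ y) := by
    refine finrank_lt_of_le_of_not_le le_sup_left fun h => hxy ?_
    exact (eq_of_le_of_finrank (le_sup_right.trans h) (by omega)).symm
  omega

theorem eq_of_two_le {x y l m : Submodule K V} (hx : finrank K x = 2) (hy : finrank K y = 2)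
    (hl : finrank K l = 3) (hm : finrank K m = 3) (hxy : x ≠ y) (hxl : x ≤ l) (hyl : y ≤ l)
    (hxm : x ≤ m) (hym : y ≤ m) : l = m := by
  rw [← eq_sup_of_le hx hy hl hxy hxl hyl, eq_sup_of_le hx hy hm hxy hxm hym]

theorem finrank_inf_of_not_le {p H : Submodule K V} {n : ℕ} (hH : finrank K H + 1 = finrank K V)
    (hp : finrank K p = n + 1) (h : ¬ p ≤ H) : finrank K ↑(p ⊓ H) = n := by
  have h1 := finrank_sup_add_inf p H
  have h2 : finrank K ↑(p ⊔ H) ≤ finrank K V := Submodule.finrank_le _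
  have h3 : finrank K H < finrank K ↑(p ⊔ H) :=
    finrank_lt_of_le_of_not_le le_sup_right fun h' => h (le_sup_left.trans h')
  omega

theorem finrank_sup_of_not_le {x P : Submodule K V} (hP : finrank K P = 1) (h : ¬ P ≤ x) :
    finrank K ↑(x ⊔ P) = finrank K x + 1 := by
  have h1 := finrank_sup_add_inf x P
  have h2 : x ⊓ P = ⊥ := by
    by_contra h'
    rw [inf_comm] at h'
    exact h (le_of_finrank_one hP h')
  rw [h2] at h1
  simp at h1
  omega

namespace IsAntiflag

variable (h : IsAntiflag H P)
include h

theorem finrank_app_hyperplane {X : Submodule K V} (hX : X ≤ H) :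
    finrank K (π.app X) + finrank K X = 4 := by
  rw [π.finrank_app_Iic hX, h.finrank_hyperplane]

theorem finrank_app_point {X : Submodule K V} (hX : P ≤ X) :
    finrank K (π'.app X) + finrank K X = 6 := by
  rw [π'.finrank_app_Ici hX, h.finrank_point, h.finrank_space]

theorem finrank_inf_hyperplane {p : Submodule K V} {n : ℕ} (hp : finrank K p = n + 1)
    (hpH : ¬ p ≤ H) : finrank K ↑(p ⊓ H) = n :=
  finrank_inf_of_not_le (by rw [h.finrank_hyperplane, h.finrank_space]) hp hpH

variable [Finite K]

theorem isConfiguration {I : ProjLine K V → ProjPlane K V → Prop}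
    (h1 : ∀ x, {l | I x l}.ncard = Nat.card K ^ 2 + Nat.card K + 1)
    (h2 : ∀ l, {x | I x l}.ncard = Nat.card K ^ 2 + Nat.card K + 1)
    (h3 : ∀ x y l m, x ≠ y → I x l → I y l → I x m → I y m → l = m) :
    IsConfiguration I ((Nat.card K ^ 2 + 1) *
        (Nat.card K ^ 4 + Nat.card K ^ 3 + Nat.card K ^ 2 + Nat.card K + 1))
      (Nat.card K ^ 2 + Nat.card K + 1) ((Nat.card K ^ 2 + 1) *
        (Nat.card K ^ 4 + Nat.card K ^ 3 + Nat.card K ^ 2 + Nat.card K + 1))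
      (Nat.card K ^ 2 + Nat.card K + 1) := by
  have hq : 1 < Nat.card K := Finite.one_lt_card
  have h4 : 3 ≤ Nat.card K ^ 2 + Nat.card K + 1 := by
    have := Nat.zero_le (Nat.card K ^ 2)
    have : 0 < Nat.card K ^ 2 := by positivity
    omega
  exact
    { finite_points := inferInstance
      finite_lines := inferInstance
      card_points := (Nat.card_coe_set_eq _).trans (ncard_lines h.finrank_space)
      card_lines := (Nat.card_coe_set_eq _).trans (ncard_planes h.finrank_space)
      point_degree := h1
      line_degree := h2
      partial_linear := h3
      three_le_point_degree := h4
      three_le_line_degree := h4 }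

theorem LP_point_degree (x : ProjLine K V) :
    {l | LP K V x l}.ncard = Nat.card K ^ 2 + Nat.card K + 1 := by
  simpa [LP] using ncard_between_three (A := x.1) (B := ⊤) (d := 3) le_top (by rw [x.2])
    (by rw [x.2]; simp [h.finrank_space])

omit [Finite K] h in
theorem _root_.SRConf.LP_partial_linear (x y : ProjLine K V) (l m : ProjPlane K V) (hxy : x ≠ y)
    (hxl : LP K V x l) (hyl : LP K V y l) (hxm : LP K V x m) (hym : LP K V y m) : l = m :=
  Subtype.ext (eq_of_two_le x.2 y.2 l.2 m.2 (fun e => hxy (Subtype.ext e)) hxl hyl hxm hym)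

/-- For x in H, the q+1 planes of H through x are traded for the q+1 planes of H through the line
π(x). -/
theorem hyperplaneTransform_point_degree (x : ProjLine K V) :
    {l | hyperplaneTransform H π (LP K V) x l}.ncard = Nat.card K ^ 2 + Nat.card K + 1 := by
  by_cases hx : x.1 ≤ H
  · simp only [hyperplaneTransform_LP_of_point_le hx]
    have hd := h.finrank_app_hyperplane (π := π) hx
    rw [x.2] at hd
    have c1 := ncard_between_two (A := π.app x.1) (B := H) (d := 3) (π.app_mem hx) (by omega)
      (by rw [h.finrank_hyperplane]; omega)
    have c2 := ncard_between_two (A := x.1) (B := H) (d := 3) hx (by rw [x.2])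
      (by rw [h.finrank_hyperplane, x.2])
    have c3 := h.LP_point_degree x
    rw [Set.ofPred_or, Set.ncard_union_eq, c1]
    · have : {l : ProjPlane K V | x.1 ≤ l.1 ∧ ¬ l.1 ≤ H} =
        {l | LP K V x l} \ {l | x.1 ≤ l.1 ∧ l.1 ≤ H} := by
        ext l; simp [LP]; tauto
      rw [this, Set.ncard_sdiff, c2, c3]
      · omega
      · exact fun l hl => hl.1
    · rw [Set.disjoint_left]
      exact fun l hl hl' => hl'.2 hl.2
  · simp only [hyperplaneTransform_LP_of_not_le_point hx]
    exact h.LP_point_degree x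

theorem hyperplaneTransform_line_degree (l : ProjPlane K V) :
    {x | hyperplaneTransform H π (LP K V) x l}.ncard = Nat.card K ^ 2 + Nat.card K + 1 := by
  by_cases hl : l.1 ≤ H
  · simp only [hyperplaneTransform_LP_of_line_le hl]
    have hd := h.finrank_app_hyperplane (π := π) hl
    rw [l.2] at hd
    exact ncard_between_three (π.app_mem hl) (by omega) (by rw [h.finrank_hyperplane]; omega)
  · simp only [hyperplaneTransform_LP_of_not_le_line hl]
    exact ncard_lines_le l.2

theorem pointTransform_point_degree (x : ProjLine K V) :
    {l | pointTransform P π' (LP K V) x l}.ncard = Nat.card K ^ 2 + Nat.card K + 1 := by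
  by_cases hx : P ≤ x.1
  · simp only [pointTransform_LP_of_le_point hx]
    have hd := h.finrank_app_point (π' := π') hx
    rw [x.2] at hd
    exact ncard_between_three' (π'.app_mem hx) (by omega) (by rw [h.finrank_point]; omega)
  · simp only [pointTransform_LP_of_not_le_point hx]
    exact h.LP_point_degree x

/-- For l through P, the q+1 lines of l through P are traded for the q+1 lines through P in the
plane π'(l). -/
theorem pointTransform_line_degree (l : ProjPlane K V) :
    {x | pointTransform P π' (LP K V) x l}.ncard = Nat.card K ^ 2 + Nat.card K + 1 := by
  by_cases hl : P ≤ l.1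
  · simp only [pointTransform_LP_of_le_line hl]
    have hd := h.finrank_app_point (π' := π') hl
    rw [l.2] at hd
    have c1 := ncard_between_two (A := P) (B := π'.app l.1) (d := 2) (π'.app_mem hl)
      (by rw [h.finrank_point]) (by rw [h.finrank_point]; omega)
    have c2 := ncard_between_two (A := P) (B := l.1) (d := 2) hl (by rw [h.finrank_point])
      (by rw [h.finrank_point, l.2])
    rw [Set.ofPred_or, Set.ncard_union_eq, c1]
    · have : {x : ProjLine K V | ¬ P ≤ x.1 ∧ x.1 ≤ l.1} =
        {x | x.1 ≤ l.1} \ {x | P ≤ x.1 ∧ x.1 ≤ l.1} := by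
        ext x; simp; tauto
      rw [this, Set.ncard_sdiff, c2, ncard_lines_le l.2]
      · omega
      · exact fun l hl => hl.2
    · rw [Set.disjoint_left]
      exact fun l hl hl' => hl'.1 hl.1
  · simp only [pointTransform_LP_of_not_le_line hl]
    exact ncard_lines_le l.2

omit [Finite K] in
-- If both planes lie in H, their poles both equal the point x ∩ y, so the planes agree. If only one
-- does, then x and y lie in H and span the other plane, a contradiction.
theorem hyperplaneTransform_partial_linear (x y : ProjLine K V) (l m : ProjPlane K V)
    (hxy : x ≠ y) (hxl : hyperplaneTransform H π (LP K V) x l)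
    (hyl : hyperplaneTransform H π (LP K V) y l) (hxm : hyperplaneTransform H π (LP K V) x m)
    (hym : hyperplaneTransform H π (LP K V) y m) : l = m := by
  by_cases hl : l.1 ≤ H
  · have hl' := hl
    rw [hyperplaneTransform_LP_of_line_le hl] at hxl hyl
    by_cases hm : m.1 ≤ H
    · rw [hyperplaneTransform_LP_of_line_le hm] at hxm hym
      apply Subtype.ext
      have dl := h.finrank_app_hyperplane (π := π) hl
      have dm := h.finrank_app_hyperplane (π := π) hm
      have d := finrank_sup_add_inf x.1 y.1
      have d1 : finrank K x.1 < finrank K ↑(x.1 ⊔ y.1) :=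
        finrank_lt_of_le_of_not_le le_sup_left fun h' => hxy (Subtype.ext
          (eq_of_le_of_finrank (le_sup_right.trans h') (by rw [x.2, y.2])).symm)
      rw [l.2] at dl
      rw [m.2] at dm
      rw [x.2, y.2] at d
      rw [x.2] at d1
      have el : π.app l.1 = x.1 ⊓ y.1 := by
        have := finrank_le_of_le (le_inf hxl.1 hyl.1)
        exact eq_of_le_of_finrank (le_inf hxl.1 hyl.1) (by omega)
      have em : π.app m.1 = x.1 ⊓ y.1 := by
        have := finrank_le_of_le (le_inf hxm.1 hym.1)
        exact eq_of_le_of_finrank (le_inf hxm.1 hym.1) (by omega)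
      exact π.app_injOn hl hm (el.trans em.symm)
    · rw [hyperplaneTransform_LP_of_not_le_line hm] at hxm hym
      exfalso
      apply hm
      rw [← eq_sup_of_le x.2 y.2 m.2 (fun e => hxy (Subtype.ext e)) hxm hym]
      exact sup_le hxl.2 hyl.2
  · rw [hyperplaneTransform_LP_of_not_le_line hl] at hxl hyl
    by_cases hm : m.1 ≤ H
    · rw [hyperplaneTransform_LP_of_line_le hm] at hxm hym
      exfalso
      apply hl
      rw [← eq_sup_of_le x.2 y.2 l.2 (fun e => hxy (Subtype.ext e)) hxl hyl]
      exact sup_le hxm.2 hym.2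
    · rw [hyperplaneTransform_LP_of_not_le_line hm] at hxm hym
      exact LP_partial_linear x y l m hxy hxl hyl hxm hym

omit [Finite K] in
-- The joining plane is determined: it is π'(x) ∩ π'(y) when both lines pass through P, and the join
-- of P with the other line when just one does.
theorem pointTransform_partial_linear (x y : ProjLine K V) (l m : ProjPlane K V)
    (hxy : x ≠ y) (hxl : pointTransform P π' (LP K V) x l)
    (hyl : pointTransform P π' (LP K V) y l) (hxm : pointTransform P π' (LP K V) x m)
    (hym : pointTransform P π' (LP K V) y m) : l = m := by
  by_cases hx : P ≤ x.1
  · rw [pointTransform_LP_of_le_point hx] at hxl hxm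
    by_cases hy : P ≤ y.1
    · rw [pointTransform_LP_of_le_point hy] at hyl hym
      apply Subtype.ext
      have hd := finrank_sup_add_inf (π'.app x.1) (π'.app y.1)
      have dx := h.finrank_app_point (π' := π') hx
      have dy := h.finrank_app_point (π' := π') hy
      have d1 : finrank K (π'.app x.1) < finrank K ↑(π'.app x.1 ⊔ π'.app y.1) :=
        finrank_lt_of_le_of_not_le le_sup_left fun h' => hxy (Subtype.ext
          (π'.app_injOn hy hx (eq_of_le_of_finrank (le_sup_right.trans h')
            (by have := x.2; have := y.2; omega))).symm)
      rw [x.2] at dx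
      rw [y.2] at dy
      have el : l.1 = π'.app x.1 ⊓ π'.app y.1 := by
        have := finrank_le_of_le (le_inf hxl.2 hyl.2)
        have := l.2
        exact eq_of_le_of_finrank (le_inf hxl.2 hyl.2) (by omega)
      have em : m.1 = π'.app x.1 ⊓ π'.app y.1 := by
        have := finrank_le_of_le (le_inf hxm.2 hym.2)
        have := m.2
        exact eq_of_le_of_finrank (le_inf hxm.2 hym.2) (by omega)
      exact el.trans em.symm
    · rw [pointTransform_LP_of_not_le_point hy] at hyl hym
      have e : ∀ n : ProjPlane K V, P ≤ n.1 → y.1 ≤ n.1 → y.1 ⊔ P = n.1 := fun n h1 h2 =>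
        eq_of_le_of_finrank (sup_le h2 h1)
          (by rw [finrank_sup_of_not_le h.finrank_point hy, y.2, n.2])
      exact Subtype.ext ((e l hxl.1 hyl).symm.trans (e m hxm.1 hym))
  · rw [pointTransform_LP_of_not_le_point hx] at hxl hxm
    by_cases hy : P ≤ y.1
    · rw [pointTransform_LP_of_le_point hy] at hyl hym
      have e : ∀ n : ProjPlane K V, P ≤ n.1 → x.1 ≤ n.1 → x.1 ⊔ P = n.1 := fun n h1 h2 =>
        eq_of_le_of_finrank (sup_le h2 h1)
          (by rw [finrank_sup_of_not_le h.finrank_point hx, x.2, n.2])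
      exact Subtype.ext ((e l hyl.1 hxl).symm.trans (e m hym.1 hxm))
    · rw [pointTransform_LP_of_not_le_point hy] at hyl hym
      exact LP_partial_linear x y l m hxy hxl hyl hxm hym

omit [Finite K] in
-- If one of the lines passes through P, so do both planes and only π' matters; otherwise only π
-- matters.
theorem both_transforms_partial_linear (x y : ProjLine K V) (l m : ProjPlane K V) (hxy : x ≠ y)
    (hxl : pointTransform P π' (hyperplaneTransform H π (LP K V)) x l)
    (hyl : pointTransform P π' (hyperplaneTransform H π (LP K V)) y l)
    (hxm : pointTransform P π' (hyperplaneTransform H π (LP K V)) x m)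
    (hym : pointTransform P π' (hyperplaneTransform H π (LP K V)) y m) : l = m := by
  have mixed : ∀ x y : ProjLine K V, x ≠ y → P ≤ x.1 →
      pointTransform P π' (hyperplaneTransform H π (LP K V)) x l →
      pointTransform P π' (hyperplaneTransform H π (LP K V)) y l →
      pointTransform P π' (hyperplaneTransform H π (LP K V)) x m →
      pointTransform P π' (hyperplaneTransform H π (LP K V)) y m → l = m := by
    intro x y hxy hx hxl hyl hxm hym
    rw [both_transforms_of_le_point h.not_le hx] at hxl hxm
    have hl := ((pointTransform_LP_of_le_point hx).1 hxl).1
    have hm := ((pointTransform_LP_of_le_point hx).1 hxm).1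
    rw [both_transforms_of_le_line h.not_le hl] at hyl
    rw [both_transforms_of_le_line h.not_le hm] at hym
    exact h.pointTransform_partial_linear x y l m hxy hxl hyl hxm hym
  by_cases hx : P ≤ x.1
  · exact mixed x y hxy hx hxl hyl hxm hym
  by_cases hy : P ≤ y.1
  · exact mixed y x hxy.symm hy hyl hxl hym hxm
  rw [both_transforms_of_not_le_point hx] at hxl hxm
  rw [both_transforms_of_not_le_point hy] at hyl hym
  exact h.hyperplaneTransform_partial_linear x y l m hxy hxl hyl hxm hym

theorem isConfiguration_fourStructures (i : Fin 4) :
    IsConfiguration (fourStructures H P π π' i) ((Nat.card K ^ 2 + 1) *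
        (Nat.card K ^ 4 + Nat.card K ^ 3 + Nat.card K ^ 2 + Nat.card K + 1))
      (Nat.card K ^ 2 + Nat.card K + 1) ((Nat.card K ^ 2 + 1) *
        (Nat.card K ^ 4 + Nat.card K ^ 3 + Nat.card K ^ 2 + Nat.card K + 1))
      (Nat.card K ^ 2 + Nat.card K + 1) := by
  fin_cases i
  · exact h.isConfiguration h.LP_point_degree (fun l => ncard_lines_le l.2) LP_partial_linear
  · exact h.isConfiguration h.hyperplaneTransform_point_degree h.hyperplaneTransform_line_degree
      h.hyperplaneTransform_partial_linear
  · exact h.isConfiguration h.pointTransform_point_degree h.pointTransform_line_degree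
      h.pointTransform_partial_linear
  · refine h.isConfiguration (I := pointTransform P π' (hyperplaneTransform H π (LP K V)))
      (fun x => ?_) (fun l => ?_) h.both_transforms_partial_linear
    · by_cases hx : P ≤ x.1
      · simp only [both_transforms_of_le_point h.not_le hx]
        exact h.pointTransform_point_degree x
      · simp only [both_transforms_of_not_le_point hx]
        exact h.hyperplaneTransform_point_degree x
    · by_cases hl : P ≤ l.1
      · simp only [both_transforms_of_le_line h.not_le hl]
        exact h.pointTransform_line_degree l
      · simp only [both_transforms_of_not_le_line hl]
        exact h.hyperplaneTransform_line_degree l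

end IsAntiflag

end Configurations

/-! ### From configurations to strongly regular graphs -/

section General

variable {P L : Type*} {I : P → L → Prop} {v r b k : ℕ}

/-- By partial linearity each neighbour of x is joined to x by exactly one line, so neighbours
correspond to pairs (l, y) with y ≠ x and both points on l. -/
theorem IsConfiguration.ncard_adj (h : IsConfiguration I v r b k) (x : P) :
    {y | (pointGraph I).Adj x y}.ncard = r * (k - 1) := by
  have := h.finite_points
  have := h.finite_lines
  have h1 := ncard_eq_mul_of_fiber (s := {F : L × P | I x F.1 ∧ I F.2 F.1 ∧ F.2 ≠ x})
    (t := {l | I x l}) (Set.toFinite _) (Set.toFinite _) Prod.fst (fun F hF => hF.1) (k - 1) ?_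
  · rw [h.point_degree] at h1
    rw [← h1]
    symm
    refine Set.ncard_congr (fun F _ => F.2) ?_ ?_ ?_
    · exact fun F hF => ⟨hF.2.2.symm, F.1, hF.1, hF.2.1⟩
    · rintro ⟨l, y⟩ ⟨m, z⟩ ⟨h1, h2, h3⟩ ⟨h1', h2', -⟩ (rfl : y = z)
      rw [h.partial_linear x y l m h3.symm h1 h2 h1' h2']
    · rintro y ⟨hxy, l, hxl, hyl⟩
      exact ⟨(l, y), ⟨hxl, hyl, hxy.symm⟩, rfl⟩
  · intro l hl
    rw [← h.line_degree l, ← Set.ncard_sdiff_singleton_of_mem (s := {x | I x l}) hl]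
    refine ncard_eq_of_inverse Prod.snd (fun y => (l, y)) ?_ ?_
    · rintro ⟨m, y⟩ ⟨⟨h1, h2, h3⟩, rfl⟩
      exact ⟨⟨h2, h3⟩, rfl⟩
    · rintro y ⟨h1, h2⟩
      exact ⟨⟨⟨hl, h1, h2⟩, rfl⟩, rfl⟩

theorem IsConfiguration.isStronglyRegular {lam mu : ℕ} (h : IsConfiguration I v k v k)
    (hlam : ∀ x y, (pointGraph I).Adj x y →
      {z | (pointGraph I).Adj x z ∧ (pointGraph I).Adj y z}.ncard = lam)
    (hmu : ∀ x y, x ≠ y → ¬ (pointGraph I).Adj x y →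
      {z | (pointGraph I).Adj x z ∧ (pointGraph I).Adj y z}.ncard = mu) :
    IsStronglyRegularConfiguration I v k lam mu := by
  classical
  have := h.finite_points
  let _ : Fintype P := Fintype.ofFinite P
  have hc : ∀ x y, Fintype.card ((pointGraph I).commonNeighbors x y) =
      {z | (pointGraph I).Adj x z ∧ (pointGraph I).Adj y z}.ncard := by
    intro x y
    rw [← Nat.card_eq_fintype_card, Nat.card_coe_set_eq]
    rfl
  refine ⟨h, inferInstance, inferInstance, ?_⟩
  refine
    { card := by rw [← Nat.card_eq_fintype_card, h.card_points]
      regular := fun x => ?_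
      of_adj := fun x y hxy => by rw [hc, hlam x y hxy]
      of_not_adj := fun x y hne hxy => by rw [hc, hmu x y hne hxy] }
  rw [← h.ncard_adj x, ← SimpleGraph.card_neighborSet_eq_degree, ← Nat.card_eq_fintype_card,
    Nat.card_coe_set_eq]
  rfl

end General

/-! ### Collinearity in the four structures -/

section PointGraphs

variable {K : Type*} [Field K] {V : Type*} [AddCommGroup V] [Module K V]
  {H P : Submodule K V} {π : Polarity (Set.Iic H)} {π' : Polarity (Set.Ici P)}
  [FiniteDimensional K V] {x y : ProjLine K V}

theorem ProjLine.finrank_sup_add_inf (x y : ProjLine K V) :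
    finrank K ↑(x.1 ⊔ y.1) + finrank K ↑(x.1 ⊓ y.1) = 4 := by
  rw [SRConf.finrank_sup_add_inf, x.2, y.2]

theorem ProjLine.three_le_finrank_sup (h : x ≠ y) : 3 ≤ finrank K ↑(x.1 ⊔ y.1) := by
  have : finrank K x.1 < finrank K ↑(x.1 ⊔ y.1) :=
    finrank_lt_of_le_of_not_le le_sup_left fun h' => h (Subtype.ext
      (eq_of_le_of_finrank (le_sup_right.trans h') (by rw [x.2, y.2])).symm)
  rw [x.2] at this
  omega

theorem ProjLine.finrank_sup_of_meet (h : x ≠ y) (hi : x.1 ⊓ y.1 ≠ ⊥) :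
    finrank K ↑(x.1 ⊔ y.1) = 3 := by
  have h1 := three_le_finrank_sup h
  have h2 := x.finrank_sup_add_inf y
  have h3 := ne_bot_iff_finrank.1 hi
  omega

theorem ProjLine.finrank_inf_of_meet (h : x ≠ y) (hi : x.1 ⊓ y.1 ≠ ⊥) :
    finrank K ↑(x.1 ⊓ y.1) = 1 := by
  have h1 := three_le_finrank_sup h
  have h2 := x.finrank_sup_add_inf y
  have h3 := ne_bot_iff_finrank.1 hi
  omega

theorem ProjLine.meet_of_le (l : ProjPlane K V) (hx : x.1 ≤ l.1) (hy : y.1 ≤ l.1) :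
    x.1 ⊓ y.1 ≠ ⊥ := by
  rw [ne_bot_iff_finrank]
  have h1 := finrank_le_of_le (sup_le hx hy)
  have h2 := x.finrank_sup_add_inf y
  rw [l.2] at h1
  omega

theorem LP_adj : (pointGraph (LP K V)).Adj x y ↔ x ≠ y ∧ x.1 ⊓ y.1 ≠ ⊥ := by
  refine and_congr_right fun hxy => ⟨?_, fun hi => ?_⟩
  · rintro ⟨l, hx, hy⟩
    exact ProjLine.meet_of_le l hx hy
  · exact ⟨⟨x.1 ⊔ y.1, ProjLine.finrank_sup_of_meet hxy hi⟩, le_sup_left, le_sup_right⟩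

namespace IsAntiflag

variable (h : IsAntiflag H P)
include h

theorem hyperplaneTransform_adj :
    (pointGraph (hyperplaneTransform H π (LP K V))).Adj x y ↔ x ≠ y ∧ x.1 ⊓ y.1 ≠ ⊥ := by
  refine and_congr_right fun hxy => ⟨?_, fun hi => ?_⟩
  · rintro ⟨l, hx, hy⟩
    by_cases hl : l.1 ≤ H
    · rw [hyperplaneTransform_LP_of_line_le hl] at hx hy
      rw [ne_bot_iff_finrank]
      have h1 := finrank_le_of_le (le_inf hx.1 hy.1)
      have h2 := h.finrank_app_hyperplane (π := π) hl
      rw [l.2] at h2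
      omega
    · rw [hyperplaneTransform_LP_of_not_le_line hl] at hx hy
      exact ProjLine.meet_of_le l hx hy
  · by_cases hH : x.1 ≤ H ∧ y.1 ≤ H
    · have hi' : x.1 ⊓ y.1 ≤ H := inf_le_left.trans hH.1
      have h1 := h.finrank_app_hyperplane (π := π) hi'
      -- The plane of H whose pole is the common point of x and y joins them.
      rw [ProjLine.finrank_inf_of_meet hxy hi] at h1
      have h2 : π.app (x.1 ⊓ y.1) ≤ H := π.app_mem hi'
      refine ⟨⟨π.app (x.1 ⊓ y.1), by omega⟩, ?_, ?_⟩ <;>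
        rw [hyperplaneTransform_LP_of_line_le h2, π.app_app (Set.mem_Iic.2 hi')]
      · exact ⟨inf_le_left, hH.1⟩
      · exact ⟨inf_le_right, hH.2⟩
    · have hl : ¬ x.1 ⊔ y.1 ≤ H := by rwa [sup_le_iff]
      refine ⟨⟨x.1 ⊔ y.1, ProjLine.finrank_sup_of_meet hxy hi⟩, ?_, ?_⟩ <;>
        rw [hyperplaneTransform_LP_of_not_le_line hl]
      · exact le_sup_left
      · exact le_sup_right

theorem pointGraph_hyperplaneTransform :
    pointGraph (hyperplaneTransform H π (LP K V)) = pointGraph (LP K V) := by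
  ext x y
  rw [h.hyperplaneTransform_adj, LP_adj]

omit h in
theorem _root_.SRConf.pointTransform_adj_of_not_le (hx : ¬ P ≤ x.1) (hy : ¬ P ≤ y.1) :
    (pointGraph (pointTransform P π' (LP K V))).Adj x y ↔ x ≠ y ∧ x.1 ⊓ y.1 ≠ ⊥ := by
  rw [← LP_adj]
  simp only [pointGraph, pointTransform_LP_of_not_le_point hx,
    pointTransform_LP_of_not_le_point hy, LP]

/-- Two lines through P span a plane, and its image under π' lies in both π'(x) and π'(y), hence
joins them. -/
theorem pointTransform_adj_of_le (hx : P ≤ x.1) (hy : P ≤ y.1) :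
    (pointGraph (pointTransform P π' (LP K V))).Adj x y ↔ x ≠ y := by
  refine and_iff_left_of_imp fun hxy => ?_
  have hP : P ≤ x.1 ⊔ y.1 := hx.trans le_sup_left
  have hi : x.1 ⊓ y.1 ≠ ⊥ := by
    rw [ne_bot_iff_finrank, ← h.finrank_point]
    exact finrank_le_of_le (le_inf hx hy)
  have h1 := h.finrank_app_point (π' := π') hP
  rw [ProjLine.finrank_sup_of_meet hxy hi] at h1
  have h2 : P ≤ π'.app (x.1 ⊔ y.1) := π'.app_mem hP
  refine ⟨⟨π'.app (x.1 ⊔ y.1), by omega⟩, ?_, ?_⟩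
  · rw [pointTransform_LP_of_le_point hx]
    exact ⟨h2, π'.app_le_app hx hP le_sup_left⟩
  · rw [pointTransform_LP_of_le_point hy]
    exact ⟨h2, π'.app_le_app hy hP le_sup_right⟩

theorem pointTransform_adj_of_le_of_not_le (hx : P ≤ x.1) (hy : ¬ P ≤ y.1) :
    (pointGraph (pointTransform P π' (LP K V))).Adj x y ↔ y.1 ≤ π'.app x.1 := by
  constructor
  · rintro ⟨-, l, hxl, hyl⟩
    rw [pointTransform_LP_of_le_point hx] at hxl
    rw [pointTransform_LP_of_not_le_point hy] at hyl
    exact hyl.trans hxl.2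
  · intro hyx
    -- A plane incident with x contains P, so the only candidate on y is y + P.
    refine ⟨fun e => hy (e ▸ hx), ⟨y.1 ⊔ P, ?_⟩, ?_, ?_⟩
    · rw [finrank_sup_of_not_le h.finrank_point hy, y.2]
    · rw [pointTransform_LP_of_le_point hx]
      exact ⟨le_sup_right, sup_le hyx (π'.app_mem hx)⟩
    · rw [pointTransform_LP_of_not_le_point hy]
      exact le_sup_left

theorem pointTransform_adj_of_not_le_of_le (hx : ¬ P ≤ x.1) (hy : P ≤ y.1) :
    (pointGraph (pointTransform P π' (LP K V))).Adj x y ↔ x.1 ≤ π'.app y.1 := by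
  rw [SimpleGraph.adj_comm, h.pointTransform_adj_of_le_of_not_le hy hx]

theorem pointGraph_both_transforms :
    pointGraph (pointTransform P π' (hyperplaneTransform H π (LP K V))) =
      pointGraph (pointTransform P π' (LP K V)) := by
  have mixed : ∀ x y : ProjLine K V, P ≤ x.1 →
      ((pointGraph (pointTransform P π' (hyperplaneTransform H π (LP K V)))).Adj x y ↔
        (pointGraph (pointTransform P π' (LP K V))).Adj x y) := by
    intro x y hx
    refine and_congr_right fun _ => exists_congr fun l => ?_
    rw [both_transforms_of_le_point h.not_le hx]
    -- A plane incident with x passes through P, so its incidence with y is also unaffected by π.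
    refine and_congr_right fun hxl => ?_
    rw [pointTransform_LP_of_le_point hx] at hxl
    rw [both_transforms_of_le_line h.not_le hxl.1]
  ext x y
  by_cases hx : P ≤ x.1
  · exact mixed x y hx
  by_cases hy : P ≤ y.1
  · rw [SimpleGraph.adj_comm, mixed y x hy, SimpleGraph.adj_comm]
  rw [pointTransform_adj_of_not_le hx hy, ← h.hyperplaneTransform_adj (π := π)]
  simp only [pointGraph, both_transforms_of_not_le_point hx, both_transforms_of_not_le_point hy]

end IsAntiflag

end PointGraphs

/-! ### Common neighbours and the parameters λ, μ -/

section CommonNeighbors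

theorem ncard_split {α : Type*} [Finite α] (R Q : α → Prop) :
    {z | Q z}.ncard = {z | R z ∧ Q z}.ncard + {z | ¬ R z ∧ Q z}.ncard := by
  rw [← Set.ncard_union_eq]
  · congr 1
    ext z
    simp only [Set.mem_union, Set.mem_ofPred_eq]
    tauto
  · rw [Set.disjoint_left]
    exact fun z h h' => h'.1 h.1

variable {K : Type*} [Field K] {V : Type*} [AddCommGroup V] [Module K V]
  {H P : Submodule K V} {π : Polarity (Set.Iic H)} {π' : Polarity (Set.Ici P)}
  [FiniteDimensional K V]

theorem le_sup_of_two_points {A B z : Submodule K V} (hz : finrank K z = 2) (hA : A ≤ z)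
    (hB : B ≤ z) (hA' : A ≠ ⊥) (hB' : B ≠ ⊥) (hAB : A ⊓ B = ⊥) : z ≤ A ⊔ B := by
  rw [ne_bot_iff_finrank] at hA' hB'
  have h1 := finrank_sup_add_inf A B
  rw [hAB, finrank_bot] at h1
  have h2 := finrank_le_of_le (sup_le hA hB)
  exact (eq_of_le_of_finrank (sup_le hA hB) (by omega)).ge

theorem meet_iff_le_sup {x z : ProjLine K V} (hP : finrank K P = 1) (hz : P ≤ z.1)
    (hx : ¬ P ≤ x.1) : x.1 ⊓ z.1 ≠ ⊥ ↔ z.1 ≤ x.1 ⊔ P := by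
  constructor
  · intro hi
    refine (le_sup_of_two_points z.2 inf_le_right hz hi ?_ ?_).trans
      (sup_le_sup_right inf_le_left P)
    · rw [ne_bot_iff_finrank, hP]
    · by_contra h
      rw [inf_comm] at h
      exact hx ((le_of_finrank_one hP h).trans inf_le_left)
  · intro hzx
    exact ProjLine.meet_of_le ⟨x.1 ⊔ P, by rw [finrank_sup_of_not_le hP hx, x.2]⟩ le_sup_left hzx

variable [Finite K]

theorem ncard_points_le_two {X : Submodule K V} (hX : finrank K X = 2) :
    {A : Submodule K V | finrank K A = 1 ∧ A ≤ X}.ncard = Nat.card K + 1 := by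
  have := ncard_between_two (A := ⊥) (B := X) (d := 1) bot_le (by simp) (by simp [hX])
  rw [ncard_subtype_finrank 1 (fun A => ⊥ ≤ A ∧ A ≤ X)] at this
  simpa using this

theorem ncard_points_le_one {X : Submodule K V} (hX : finrank K X = 1) :
    {A : Submodule K V | finrank K A = 1 ∧ A ≤ X}.ncard = 1 := by
  have := ncard_between_one (A := ⊥) (B := X) (d := 1) bot_le (by simp) (by simp [hX])
  rw [ncard_subtype_finrank 1 (fun A => ⊥ ≤ A ∧ A ≤ X)] at this
  simpa using this

/-- The lines of a plane that avoid a given point of the plane. -/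
theorem ncard_lines_avoiding {W : Submodule K V} (hP : finrank K P = 1) (hW : finrank K W = 3)
    (hPW : P ≤ W) : {z : ProjLine K V | ¬ P ≤ z.1 ∧ z.1 ≤ W}.ncard = Nat.card K ^ 2 := by
  have h1 := ncard_split (fun z : ProjLine K V => P ≤ z.1) (fun z => z.1 ≤ W)
  rw [ncard_lines_le hW, ncard_between_two (d := 2) hPW (by rw [hP]) (by rw [hP, hW])] at h1
  omega

/-- There are q^3+q^2+q+1 lines through the common point and q^2+q+1 in the common plane; q+1 are
counted twice, and x and y are removed. -/
theorem LP_lambda (hV : finrank K V = 5) {x y : ProjLine K V} (hxy : (pointGraph (LP K V)).Adj x y) :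
    {z | (pointGraph (LP K V)).Adj x z ∧ (pointGraph (LP K V)).Adj y z}.ncard =
      Nat.card K ^ 3 + 2 * Nat.card K ^ 2 + Nat.card K - 1 := by
  simp only [LP_adj] at hxy ⊢
  obtain ⟨hne, hi⟩ := hxy
  have hR := ProjLine.finrank_inf_of_meet hne hi
  have hp := ProjLine.finrank_sup_of_meet hne hi
  have hset : {z : ProjLine K V | (x ≠ z ∧ x.1 ⊓ z.1 ≠ ⊥) ∧ (y ≠ z ∧ y.1 ⊓ z.1 ≠ ⊥)} =
      ({z | x.1 ⊓ y.1 ≤ z.1} ∪ {z | z.1 ≤ x.1 ⊔ y.1}) \ {x, y} := by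
    ext z
    simp only [Set.mem_sdiff, Set.mem_union, Set.mem_ofPred_eq, Set.mem_insert_iff,
      Set.mem_singleton_iff, not_or]
    constructor
    · rintro ⟨⟨h1, h2⟩, h3, h4⟩
      refine ⟨?_, fun e => h1 e.symm, fun e => h3 e.symm⟩
      by_cases hRz : x.1 ⊓ y.1 ≤ z.1
      · exact Or.inl hRz
      -- A line z missing the point x ∩ y meets x and y in different points, hence lies in their
      -- plane.
      · refine Or.inr ((le_sup_of_two_points z.2 inf_le_right inf_le_right h2 h4 ?_).trans
          (sup_le_sup inf_le_left inf_le_left))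
        by_contra h
        rw [← inf_inf_distrib_right] at h
        exact hRz (le_of_finrank_one hR h)
    · rintro ⟨h, h1, h2⟩
      suffices hh : x.1 ⊓ z.1 ≠ ⊥ ∧ y.1 ⊓ z.1 ≠ ⊥ from
        ⟨⟨fun e => h1 e.symm, hh.1⟩, fun e => h2 e.symm, hh.2⟩
      rcases h with h | h
      · exact ⟨ne_bot_of_le_ne_bot hi (le_inf inf_le_left h),
          ne_bot_of_le_ne_bot hi (le_inf inf_le_right h)⟩
      · exact ⟨ProjLine.meet_of_le ⟨_, hp⟩ le_sup_left h, ProjLine.meet_of_le ⟨_, hp⟩ le_sup_right h⟩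
  have h1 := ncard_between_four (A := x.1 ⊓ y.1) (B := ⊤) (d := 2) le_top (by rw [hR])
    (by rw [hR, finrank_top, hV])
  simp only [le_top, and_true] at h1
  have h2 := ncard_between_two (A := x.1 ⊓ y.1) (B := x.1 ⊔ y.1) (d := 2)
    (inf_le_left.trans le_sup_left) (by rw [hR]) (by rw [hR, hp])
  have h3 := ncard_lines_le hp
  have h4 := Set.ncard_union_add_ncard_inter {z : ProjLine K V | x.1 ⊓ y.1 ≤ z.1}
    {z | z.1 ≤ x.1 ⊔ y.1}
  rw [← Set.ofPred_and, h1, h2, h3] at h4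
  rw [hset, Set.ncard_sdiff, Set.ncard_pair hne]
  · omega
  · rintro z (rfl | rfl)
    · exact Or.inl (Set.mem_ofPred.2 inf_le_left)
    · exact Or.inl (Set.mem_ofPred.2 inf_le_right)

/-- A transversal z of the skew lines x and y is sorted by the point A = x ∩ z; those through A are
the q+1 lines through A in the plane y + A. -/
theorem LP_mu {x y : ProjLine K V} (hne : x ≠ y) (hxy : ¬ (pointGraph (LP K V)).Adj x y) :
    {z | (pointGraph (LP K V)).Adj x z ∧ (pointGraph (LP K V)).Adj y z}.ncard =
      (Nat.card K + 1) ^ 2 := by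
  simp only [LP_adj, not_and, not_not] at hxy ⊢
  replace hxy := hxy hne
  rw [sq, ← ncard_points_le_two x.2]
  nth_rewrite 2 [ncard_points_le_two x.2]
  refine ncard_eq_mul_of_fiber (Set.toFinite _) (Set.toFinite _) (fun z => x.1 ⊓ z.1) ?_ _ ?_
  · rintro z ⟨⟨h1, h2⟩, -⟩
    exact ⟨ProjLine.finrank_inf_of_meet h1 h2, inf_le_left⟩
  · rintro A ⟨hA, hAx⟩
    have hAy : ¬ A ≤ y.1 := by
      intro h
      have := le_inf hAx h
      rw [hxy, le_bot_iff] at this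
      rw [this, finrank_bot] at hA
      omega
    have hAy' : finrank K ↑(y.1 ⊔ A) = 3 := by rw [finrank_sup_of_not_le hA hAy, y.2]
    rw [← ncard_between_two (A := A) (B := y.1 ⊔ A) (d := 2) le_sup_right (by rw [hA])
      (by rw [hA, hAy'])]
    congr 1
    ext z
    constructor
    · rintro ⟨⟨⟨h1, h2⟩, h3, h4⟩, rfl⟩
      refine ⟨inf_le_right, (le_sup_of_two_points z.2 inf_le_right inf_le_right h4 h2 ?_).trans
        (sup_le_sup_right inf_le_left _)⟩
      rw [← inf_inf_distrib_right, inf_comm y.1, hxy, bot_inf_eq]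
    · rintro ⟨h1, h2⟩
      have hA0 : A ≠ ⊥ := by rw [ne_bot_iff_finrank, hA]
      have hxz : x ≠ z := by
        rintro rfl
        exact ProjLine.meet_of_le ⟨_, hAy'⟩ h2 le_sup_left hxy
      have hxz' : x.1 ⊓ z.1 ≠ ⊥ := ne_bot_of_le_ne_bot hA0 (le_inf hAx h1)
      refine ⟨⟨⟨hxz, hxz'⟩, ?_, ProjLine.meet_of_le ⟨_, hAy'⟩ le_sup_left h2⟩, ?_⟩
      · rintro rfl
        exact hAy h1
      · exact (eq_of_le_of_finrank (le_inf hAx h1)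
          (by rw [hA, ProjLine.finrank_inf_of_meet hxz hxz'])).symm

namespace IsAntiflag

variable (h : IsAntiflag H P)
include h

omit [FiniteDimensional K V] [Finite K] h in
theorem _root_.SRConf.app_sup_Ici {X Y : Submodule K V} (hX : P ≤ X) (hY : P ≤ Y) :
    π'.app (X ⊔ Y) = π'.app X ⊓ π'.app Y := by
  have hXY : P ≤ X ⊔ Y := hX.trans le_sup_left
  have hi : P ≤ π'.app X ⊓ π'.app Y := le_inf (π'.app_mem hX) (π'.app_mem hY)
  refine le_antisymm (le_inf (π'.app_le_app hX hXY le_sup_left)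
    (π'.app_le_app hY hXY le_sup_right)) ?_
  rw [π'.le_app_iff hi hXY]
  refine sup_le ?_ ?_
  · rw [π'.le_app_iff hX hi]
    exact inf_le_left
  · rw [π'.le_app_iff hY hi]
    exact inf_le_right

/-- The polarity preserves the number of projective lines in the intersection of two planes. -/
theorem ncard_lines_inf_app {X Y : Submodule K V} (hX : P ≤ X) (hY : P ≤ Y)
    (dX : finrank K X = 3) (dY : finrank K Y = 3) :
    {z : ProjLine K V | P ≤ z.1 ∧ z.1 ≤ π'.app X ⊓ π'.app Y}.ncard =
      {z : ProjLine K V | P ≤ z.1 ∧ z.1 ≤ X ⊓ Y}.ncard := by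
  have h1 := h.finrank_app_point (π' := π') (hX.trans (le_sup_left : X ≤ X ⊔ Y))
  rw [app_sup_Ici hX hY] at h1
  have h2 := finrank_sup_add_inf X Y
  have hi : P ≤ π'.app X ⊓ π'.app Y := le_inf (π'.app_mem hX) (π'.app_mem hY)
  have h3 := finrank_le_of_le hi
  rw [h.finrank_point] at h3
  have h4 := h.finrank_point
  -- Both intersections have the same dimension: π'(X) ∩ π'(Y) = π'(X+Y) has dimension 6 - dim(X+Y)
  -- = dim(X ∩ Y).
  rw [ncard_between_of_add_one (n := finrank K ↑(X ⊓ Y) - 1) hi (by omega) (by omega),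
    ncard_between_of_add_one (n := finrank K ↑(X ⊓ Y) - 1) (le_inf hX hY) (by omega) (by omega)]

omit [Finite K] in
-- Compared with `LP_adj_iff_le_sup`, the plane x + P is replaced by its image under π'; this is the
-- whole effect on a line off P.
theorem pointTransform_adj_iff_le_app {x z : ProjLine K V} (hx : ¬ P ≤ x.1) (hz : P ≤ z.1) :
    (pointGraph (pointTransform P π' (LP K V))).Adj x z ↔ z.1 ≤ π'.app (x.1 ⊔ P) := by
  rw [h.pointTransform_adj_of_not_le_of_le hx hz,
    π'.le_app_iff (Set.mem_Ici.2 hz) (Set.mem_Ici.2 le_sup_right), sup_le_iff]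
  exact ⟨fun h => ⟨h, π'.app_mem hz⟩, fun h => h.1⟩

omit [Finite K] in
theorem LP_adj_iff_le_sup {x z : ProjLine K V} (hx : ¬ P ≤ x.1) (hz : P ≤ z.1) :
    (pointGraph (LP K V)).Adj x z ↔ z.1 ≤ x.1 ⊔ P := by
  rw [LP_adj, meet_iff_le_sup h.finrank_point hz hx]
  exact and_iff_right (fun e => hx (e ▸ hz))

/-- Away from `P`, the numbers of common neighbours are the same in both point graphs. -/
theorem ncard_commonNeighbors_of_not_le {x y : ProjLine K V} (hx : ¬ P ≤ x.1) (hy : ¬ P ≤ y.1) :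
    {z | (pointGraph (pointTransform P π' (LP K V))).Adj x z ∧
      (pointGraph (pointTransform P π' (LP K V))).Adj y z}.ncard =
    {z | (pointGraph (LP K V)).Adj x z ∧ (pointGraph (LP K V)).Adj y z}.ncard := by
  rw [ncard_split (fun z => P ≤ z.1), ncard_split (fun z => P ≤ z.1)
    (fun z => (pointGraph (LP K V)).Adj x z ∧ (pointGraph (LP K V)).Adj y z)]
  congr 1
  · have hd : ∀ x : ProjLine K V, ¬ P ≤ x.1 → finrank K ↑(x.1 ⊔ P) = 3 := fun x hx => by
      rw [finrank_sup_of_not_le h.finrank_point hx, x.2]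
    -- Common neighbours through P fill X ∩ Y before the change and π'(X) ∩ π'(Y) after it, where X
    -- = x + P and Y = y + P.
    have key := h.ncard_lines_inf_app (π' := π') (X := x.1 ⊔ P) (Y := y.1 ⊔ P) le_sup_right
      le_sup_right (hd x hx) (hd y hy)
    convert key using 2
    · ext z
      simp only [Set.mem_ofPred_eq, le_inf_iff]
      refine and_congr_right fun hz => ?_
      rw [h.pointTransform_adj_iff_le_app hx hz, h.pointTransform_adj_iff_le_app hy hz]
    · ext z
      simp only [Set.mem_ofPred_eq, le_inf_iff]
      refine and_congr_right fun hz => ?_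
      rw [h.LP_adj_iff_le_sup hx hz, h.LP_adj_iff_le_sup hy hz]
  · congr 1
    ext z
    simp only [Set.mem_ofPred_eq]
    refine and_congr_right fun hz => ?_
    rw [pointTransform_adj_of_not_le hx hz, pointTransform_adj_of_not_le hy hz, LP_adj, LP_adj]

/-- All q^3+q^2+q-1 further lines through P count, and so do the q^2 lines off P in the plane π'(x)
∩ π'(y) = π'(x+y). -/
theorem ncard_commonNeighbors_of_le {x y : ProjLine K V} (hne : x ≠ y) (hx : P ≤ x.1)
    (hy : P ≤ y.1) :
    {z | (pointGraph (pointTransform P π' (LP K V))).Adj x z ∧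
      (pointGraph (pointTransform P π' (LP K V))).Adj y z}.ncard =
      Nat.card K ^ 3 + 2 * Nat.card K ^ 2 + Nat.card K - 1 := by
  rw [ncard_split (fun z => P ≤ z.1)]
  have h1 : {z : ProjLine K V | P ≤ z.1 ∧ (pointGraph (pointTransform P π' (LP K V))).Adj x z ∧
      (pointGraph (pointTransform P π' (LP K V))).Adj y z} = {z | P ≤ z.1} \ {x, y} := by
    ext z
    simp only [Set.mem_sdiff, Set.mem_ofPred_eq, Set.mem_insert_iff, Set.mem_singleton_iff, not_or]
    refine and_congr_right fun hz => ?_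
    rw [h.pointTransform_adj_of_le hx hz, h.pointTransform_adj_of_le hy hz, ne_comm, ne_comm (a := y)]
  have h2 := ncard_between_four (A := P) (B := ⊤) (d := 2) le_top (by rw [h.finrank_point])
    (by rw [h.finrank_point, finrank_top, h.finrank_space])
  simp only [le_top, and_true] at h2
  have h3 : {z : ProjLine K V | ¬ P ≤ z.1 ∧ (pointGraph (pointTransform P π' (LP K V))).Adj x z ∧
      (pointGraph (pointTransform P π' (LP K V))).Adj y z} =
      {z | ¬ P ≤ z.1 ∧ z.1 ≤ π'.app (x.1 ⊔ y.1)} := by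
    ext z
    simp only [Set.mem_ofPred_eq]
    refine and_congr_right fun hz => ?_
    rw [h.pointTransform_adj_of_le_of_not_le hx hz, h.pointTransform_adj_of_le_of_not_le hy hz,
      app_sup_Ici hx hy, le_inf_iff]
  have hP : P ≤ x.1 ⊔ y.1 := hx.trans le_sup_left
  have h4 := h.finrank_app_point (π' := π') hP
  have hi : x.1 ⊓ y.1 ≠ ⊥ := by
    rw [ne_bot_iff_finrank, ← h.finrank_point]
    exact finrank_le_of_le (le_inf hx hy)
  rw [ProjLine.finrank_sup_of_meet hne hi] at h4
  rw [h1, h3, Set.ncard_sdiff (by rintro z (rfl | rfl) <;> assumption), Set.ncard_pair hne, h2,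
    ncard_lines_avoiding h.finrank_point (by omega) (π'.app_mem hP)]
  have hq : 0 < Nat.card K := Nat.card_pos
  have : 0 < Nat.card K ^ 2 := by positivity
  omega

/-- Lines in a solid `S` through `P` that avoid `P` and meet a line `y`. -/
theorem ncard_lines_meeting {y : ProjLine K V} {S : Submodule K V} (hy : ¬ P ≤ y.1) (hPS : P ≤ S)
    {c : ℕ}
    (hc : ∀ A : Submodule K V, finrank K A = 1 → A ≤ y.1 → A ≤ S → ∀ w : ProjLine K V, w ≠ y →
      A ≤ w.1 → w.1 ≤ S → ({z : ProjLine K V | A ≤ z.1 ∧ z.1 ≤ S} \ {y, w}).ncard = c) :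
    {z : ProjLine K V | ¬ P ≤ z.1 ∧ z.1 ≤ S ∧ y ≠ z ∧ y.1 ⊓ z.1 ≠ ⊥}.ncard =
      {A : Submodule K V | finrank K A = 1 ∧ A ≤ y.1 ⊓ S}.ncard * c := by
  refine ncard_eq_mul_of_fiber (Set.toFinite _) (Set.toFinite _) (fun z => y.1 ⊓ z.1) ?_ _ ?_
  · rintro z ⟨-, h1, h2, h3⟩
    exact ⟨ProjLine.finrank_inf_of_meet h2 h3, inf_le_inf_left _ h1⟩
  · rintro A ⟨hA, hAy⟩
    rw [le_inf_iff] at hAy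
    have hPA : ¬ P ≤ A := fun h' => hy (h'.trans hAy.1)
    have hw : finrank K ↑(A ⊔ P) = 2 := by rw [finrank_sup_of_not_le h.finrank_point hPA, hA]
    -- The line w = A + P is the only line through A that passes through P, so avoiding P amounts to
    -- removing w.
    rw [← hc A hA hAy.1 hAy.2 ⟨A ⊔ P, hw⟩ (by rintro rfl; exact hy le_sup_right) le_sup_left
      (sup_le hAy.2 hPS)]
    congr 1
    ext z
    constructor
    · rintro ⟨⟨h1, h2, h3, h4⟩, rfl⟩
      refine ⟨⟨inf_le_right, h2⟩, ?_⟩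
      rintro (e | e)
      · exact h3 e.symm
      · refine h1 (le_sup_right.trans_eq (congrArg Subtype.val (Set.mem_singleton_iff.1 e)).symm)
    · rintro ⟨⟨h1, h2⟩, h3⟩
      simp only [Set.mem_insert_iff, Set.mem_singleton_iff, not_or] at h3
      have hA0 : A ≠ ⊥ := by rw [ne_bot_iff_finrank, hA]
      have hyz : y.1 ⊓ z.1 ≠ ⊥ := ne_bot_of_le_ne_bot hA0 (le_inf hAy.1 h1)
      have hne : y ≠ z := fun e => h3.1 e.symm
      refine ⟨⟨fun hz => h3.2 (Subtype.ext ?_), h2, hne, hyz⟩, ?_⟩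
      · exact (eq_of_le_of_finrank (sup_le h1 hz) (by rw [hw, z.2])).symm
      · exact (eq_of_le_of_finrank (le_inf hAy.1 h1)
          (by rw [hA, ProjLine.finrank_inf_of_meet hne hyz])).symm

open Classical in
-- Common neighbours through P are the lines of the pencil in π'(y+P) other than x; those off P lie
-- in the solid S = π'(x) and meet y. Each point of y in S is on q^2+q+1 lines of S, from which its
-- join with P and, if y lies in S, also y must be removed.
theorem ncard_commonNeighbors_of_le_of_not_le {x y : ProjLine K V} (hx : P ≤ x.1)
    (hy : ¬ P ≤ y.1) :
    {z | (pointGraph (pointTransform P π' (LP K V))).Adj x z ∧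
      (pointGraph (pointTransform P π' (LP K V))).Adj y z}.ncard =
      if y.1 ≤ π'.app x.1 then Nat.card K ^ 3 + 2 * Nat.card K ^ 2 + Nat.card K - 1
      else (Nat.card K + 1) ^ 2 := by
  rw [ncard_split (fun z => P ≤ z.1)]
  have hS := h.finrank_app_point (π' := π') hx
  have hPS : P ≤ π'.app x.1 := π'.app_mem hx
  rw [x.2] at hS
  have hyP : finrank K ↑(y.1 ⊔ P) = 3 := by rw [finrank_sup_of_not_le h.finrank_point hy, y.2]
  have hPy : P ≤ y.1 ⊔ P := le_sup_right
  have hd := h.finrank_app_point (π' := π') hPy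
  have h1 : {z : ProjLine K V | P ≤ z.1 ∧ (pointGraph (pointTransform P π' (LP K V))).Adj x z ∧
      (pointGraph (pointTransform P π' (LP K V))).Adj y z} =
      {z | P ≤ z.1 ∧ z.1 ≤ π'.app (y.1 ⊔ P)} \ {x} := by
    ext z
    simp only [Set.mem_sdiff, Set.mem_ofPred_eq, Set.mem_singleton_iff, and_assoc]
    refine and_congr_right fun hz => ?_
    rw [h.pointTransform_adj_of_le hx hz, h.pointTransform_adj_iff_le_app hy hz, and_comm, ne_comm]
  have h2 := ncard_between_two (A := P) (B := π'.app (y.1 ⊔ P)) (d := 2) (π'.app_mem hPy)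
    (by rw [h.finrank_point]) (by rw [h.finrank_point]; omega)
  have hxy : y.1 ≤ π'.app x.1 ↔ x.1 ≤ π'.app (y.1 ⊔ P) := by
    rw [← h.pointTransform_adj_iff_le_app hy hx, h.pointTransform_adj_of_not_le_of_le hy hx]
  have h3 : {z : ProjLine K V | ¬ P ≤ z.1 ∧ (pointGraph (pointTransform P π' (LP K V))).Adj x z ∧
      (pointGraph (pointTransform P π' (LP K V))).Adj y z} =
      {z | ¬ P ≤ z.1 ∧ z.1 ≤ π'.app x.1 ∧ y ≠ z ∧ y.1 ⊓ z.1 ≠ ⊥} := by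
    ext z
    simp only [Set.mem_ofPred_eq]
    refine and_congr_right fun hz => ?_
    rw [h.pointTransform_adj_of_le_of_not_le hx hz, pointTransform_adj_of_not_le hy hz]
  have hcard : ∀ A : Submodule K V, finrank K A = 1 → A ≤ π'.app x.1 →
      {z : ProjLine K V | A ≤ z.1 ∧ z.1 ≤ π'.app x.1}.ncard = Nat.card K ^ 2 + Nat.card K + 1 :=
    fun A hA hAS => ncard_between_three hAS (by rw [hA]) (by rw [hA]; omega)
  rw [h1, h3]
  split_ifs with hyx
  -- Here y is in S and x is in the pencil: q + (q+1)(q^2+q-1) = λ.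
  · rw [h.ncard_lines_meeting hy hPS (c := Nat.card K ^ 2 + Nat.card K - 1),
      inf_eq_left.2 hyx, ncard_points_le_two y.2,
      Set.ncard_sdiff_singleton_of_mem
        (show x ∈ {z : ProjLine K V | P ≤ z.1 ∧ z.1 ≤ π'.app (y.1 ⊔ P)} from ⟨hx, hxy.1 hyx⟩), h2]
    · have hq : 0 < Nat.card K := Nat.card_pos
      -- Writing q = n + 1 removes the truncated subtractions.
      obtain ⟨n, hn⟩ : ∃ n, Nat.card K = n + 1 := ⟨Nat.card K - 1, by omega⟩
      rw [hn]
      have e1 : (n + 1) ^ 2 + (n + 1) - 1 = n ^ 2 + 3 * n + 1 := by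
        rw [Nat.sub_eq_iff_eq_add (by omega)]; ring
      have e2 : (n + 1) ^ 3 + 2 * (n + 1) ^ 2 + (n + 1) - 1 = n ^ 3 + 5 * n ^ 2 + 8 * n + 3 := by
        rw [Nat.sub_eq_iff_eq_add (by omega)]; ring
      rw [e1, e2, Nat.add_sub_cancel]
      ring
    · intro A hA hAy hAS w hw hAw hwS
      rw [Set.ncard_sdiff, Set.ncard_pair hw.symm, hcard A hA hAS]
      · omega
      · rintro z (rfl | rfl)
        · exact ⟨hAy, hyx⟩
        · exact ⟨hAw, hwS⟩
  -- Here y meets S in one point and x is not in the pencil: (q+1) + (q^2+q) = (q+1)^2.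
  · rw [h.ncard_lines_meeting hy hPS (c := Nat.card K ^ 2 + Nat.card K),
      ncard_points_le_one, Set.sdiff_singleton_eq_self, h2]
    · ring
    · exact fun hh => hyx (hxy.2 hh.2)
    · exact finrank_inf_of_not_le (by rw [h.finrank_space]; omega) y.2 hyx
    · intro A hA hAy hAS w hw hAw hwS
      have : {z : ProjLine K V | A ≤ z.1 ∧ z.1 ≤ π'.app x.1} \ {y, w} =
          {z : ProjLine K V | A ≤ z.1 ∧ z.1 ≤ π'.app x.1} \ {w} := by
        ext z
        simp only [Set.mem_sdiff, Set.mem_ofPred_eq, Set.mem_insert_iff, Set.mem_singleton_iff,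
          not_or]
        refine and_congr_right fun hz => and_iff_right ?_
        rintro rfl
        exact hyx hz.2
      rw [this, Set.ncard_sdiff_singleton_of_mem
        (show w ∈ {z : ProjLine K V | A ≤ z.1 ∧ z.1 ≤ π'.app x.1} from ⟨hAw, hwS⟩), hcard A hA hAS]
      omega

theorem pointTransform_lambda {x y : ProjLine K V}
    (hxy : (pointGraph (pointTransform P π' (LP K V))).Adj x y) :
    {z | (pointGraph (pointTransform P π' (LP K V))).Adj x z ∧
      (pointGraph (pointTransform P π' (LP K V))).Adj y z}.ncard =
      Nat.card K ^ 3 + 2 * Nat.card K ^ 2 + Nat.card K - 1 := by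
  by_cases hx : P ≤ x.1
  · by_cases hy : P ≤ y.1
    · exact h.ncard_commonNeighbors_of_le hxy.ne hx hy
    · rw [h.ncard_commonNeighbors_of_le_of_not_le hx hy,
        if_pos ((h.pointTransform_adj_of_le_of_not_le hx hy).1 hxy)]
  · by_cases hy : P ≤ y.1
    · simp only [and_comm (a := (pointGraph (pointTransform P π' (LP K V))).Adj x _)]
      rw [h.ncard_commonNeighbors_of_le_of_not_le hy hx,
        if_pos ((h.pointTransform_adj_of_not_le_of_le hx hy).1 hxy)]
    · rw [h.ncard_commonNeighbors_of_not_le hx hy, LP_lambda h.finrank_space]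
      rwa [LP_adj, ← pointTransform_adj_of_not_le hx hy]

theorem pointTransform_mu {x y : ProjLine K V} (hne : x ≠ y)
    (hxy : ¬ (pointGraph (pointTransform P π' (LP K V))).Adj x y) :
    {z | (pointGraph (pointTransform P π' (LP K V))).Adj x z ∧
      (pointGraph (pointTransform P π' (LP K V))).Adj y z}.ncard = (Nat.card K + 1) ^ 2 := by
  by_cases hx : P ≤ x.1
  · by_cases hy : P ≤ y.1
    · exact (hxy ((h.pointTransform_adj_of_le hx hy).2 hne)).elim
    · rw [h.ncard_commonNeighbors_of_le_of_not_le hx hy,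
        if_neg (fun hh => hxy ((h.pointTransform_adj_of_le_of_not_le hx hy).2 hh))]
  · by_cases hy : P ≤ y.1
    · simp only [and_comm (a := (pointGraph (pointTransform P π' (LP K V))).Adj x _)]
      rw [h.ncard_commonNeighbors_of_le_of_not_le hy hx,
        if_neg (fun hh => hxy ((h.pointTransform_adj_of_not_le_of_le hx hy).2 hh))]
    · rw [h.ncard_commonNeighbors_of_not_le hx hy, LP_mu hne]
      rwa [LP_adj, ← pointTransform_adj_of_not_le hx hy]

theorem isStronglyRegular_fourStructures (i : Fin 4) :
    IsStronglyRegularConfiguration (fourStructures H P π π' i) ((Nat.card K ^ 2 + 1) *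
        (Nat.card K ^ 4 + Nat.card K ^ 3 + Nat.card K ^ 2 + Nat.card K + 1))
      (Nat.card K ^ 2 + Nat.card K + 1)
      (Nat.card K ^ 3 + 2 * Nat.card K ^ 2 + Nat.card K - 1) ((Nat.card K + 1) ^ 2) := by
  -- Only two point graphs occur, since π changes neither.
  have hi : pointGraph (fourStructures H P π π' i) = pointGraph (LP K V) ∨
      pointGraph (fourStructures H P π π' i) = pointGraph (pointTransform P π' (LP K V)) := by
    fin_cases i
    · exact Or.inl rfl
    · exact Or.inl h.pointGraph_hyperplaneTransform
    · exact Or.inr rfl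
    · exact Or.inr h.pointGraph_both_transforms
  refine (h.isConfiguration_fourStructures i).isStronglyRegular ?_ ?_ <;>
    rcases hi with hi | hi <;> rw [hi]
  · exact fun x y => LP_lambda h.finrank_space
  · exact fun x y => h.pointTransform_lambda
  · exact fun x y => LP_mu
  · exact fun x y => h.pointTransform_mu

end IsAntiflag

end CommonNeighbors

/-! ### Exceptional pairs and isomorphism invariants -/

section Exceptional

variable {P L P' L' : Type*}

/-- The number of points on `l` collinear with `x`. -/
noncomputable def collinearCount (I : P → L → Prop) (x : P) (l : L) : ℕ :=
  {y | I y l ∧ (pointGraph I).Adj x y}.ncard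

/-- A non-incident point-line pair whose number of collinear points is neither `0` nor `α`. -/
def IsExceptional (I : P → L → Prop) (α : ℕ) (x : P) (l : L) : Prop :=
  ¬ I x l ∧ ¬ (collinearCount I x l = 0 ∨ collinearCount I x l = α)

theorem Isomorphic.symm {I : P → L → Prop} {J : P' → L' → Prop} (h : Isomorphic I J) :
    Isomorphic J I := by
  obtain ⟨f, g, hfg⟩ := h
  exact ⟨f.symm, g.symm, fun x l => by rw [hfg]; simp⟩

theorem adj_iff_of_equiv {I : P → L → Prop} {J : P' → L' → Prop} (f : P ≃ P') (g : L ≃ L')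
    (hfg : ∀ x l, I x l ↔ J (f x) (g l)) (x y : P) :
    (pointGraph I).Adj x y ↔ (pointGraph J).Adj (f x) (f y) := by
  refine and_congr f.injective.ne_iff.symm ?_
  constructor
  · rintro ⟨l, hx, hy⟩
    exact ⟨g l, (hfg _ _).1 hx, (hfg _ _).1 hy⟩
  · rintro ⟨l, hx, hy⟩
    exact ⟨g.symm l, by rw [hfg]; simpa using hx, by rw [hfg]; simpa using hy⟩

theorem isExceptional_iff_of_equiv {I : P → L → Prop} {J : P' → L' → Prop} (f : P ≃ P')
    (g : L ≃ L') (hfg : ∀ x l, I x l ↔ J (f x) (g l)) (α : ℕ) (x : P) (l : L) :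
    IsExceptional I α x l ↔ IsExceptional J α (f x) (g l) := by
  have hc : collinearCount I x l = collinearCount J (f x) (g l) := by
    refine ncard_eq_of_inverse f f.symm (fun y hy => ⟨⟨?_, ?_⟩, by simp⟩)
      (fun y hy => ⟨⟨?_, ?_⟩, by simp⟩)
    · exact (hfg _ _).1 hy.1
    · exact (adj_iff_of_equiv f g hfg _ _).1 hy.2
    · rw [hfg]; simpa using hy.1
    · rw [adj_iff_of_equiv f g hfg]; simpa using hy.2
  rw [IsExceptional, IsExceptional, hc, hfg]

/-- Exceptional pairs exist. -/
def HasExceptional (I : P → L → Prop) (α : ℕ) : Prop := ∃ x l, IsExceptional I α x l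

/-- Some point of an exceptional pair lies on the line of an exceptional pair. -/
def HasIncidentExceptional (I : P → L → Prop) (α : ℕ) : Prop :=
  ∃ x l y m, I x l ∧ IsExceptional I α x m ∧ IsExceptional I α y l

/-- There are two non-collinear points of exceptional pairs. -/
def HasNonCollinearExceptional (I : P → L → Prop) (α : ℕ) : Prop :=
  ∃ x l y m, x ≠ y ∧ ¬ (pointGraph I).Adj x y ∧ IsExceptional I α x l ∧ IsExceptional I α y m

variable {I : P → L → Prop} {J : P' → L' → Prop} {α : ℕ}

theorem HasExceptional.of_isomorphic (h : Isomorphic I J) (hI : HasExceptional I α) :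
    HasExceptional J α := by
  obtain ⟨f, g, hfg⟩ := h
  obtain ⟨x, l, hxl⟩ := hI
  exact ⟨f x, g l, (isExceptional_iff_of_equiv f g hfg α x l).1 hxl⟩

theorem HasIncidentExceptional.of_isomorphic (h : Isomorphic I J)
    (hI : HasIncidentExceptional I α) : HasIncidentExceptional J α := by
  obtain ⟨f, g, hfg⟩ := h
  obtain ⟨x, l, y, m, h1, h2, h3⟩ := hI
  exact ⟨f x, g l, f y, g m, (hfg _ _).1 h1, (isExceptional_iff_of_equiv f g hfg α _ _).1 h2,
    (isExceptional_iff_of_equiv f g hfg α _ _).1 h3⟩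

theorem HasNonCollinearExceptional.of_isomorphic (h : Isomorphic I J)
    (hI : HasNonCollinearExceptional I α) : HasNonCollinearExceptional J α := by
  obtain ⟨f, g, hfg⟩ := h
  obtain ⟨x, l, y, m, h1, h2, h3, h4⟩ := hI
  exact ⟨f x, g l, f y, g m, f.injective.ne h1, by rwa [← adj_iff_of_equiv f g hfg],
    (isExceptional_iff_of_equiv f g hfg α _ _).1 h3,
    (isExceptional_iff_of_equiv f g hfg α _ _).1 h4⟩

theorem not_isSemipartialGeometry {a b : ℕ} (ha : a ≠ 0) (hb : b ≠ 0) (hab : a ≠ b)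
    (h1 : ∃ x l, ¬ I x l ∧ collinearCount I x l = a)
    (h2 : ∃ x l, ¬ I x l ∧ collinearCount I x l = b) (s t α μ : ℕ) :
    ¬ IsSemipartialGeometry I s t α μ := by
  intro h
  obtain ⟨x, l, hxl, hx⟩ := h1
  obtain ⟨y, m, hym, hy⟩ := h2
  have e1 : collinearCount I x l = 0 ∨ collinearCount I x l = α := h.zero_or_alpha x l hxl
  have e2 : collinearCount I y m = 0 ∨ collinearCount I y m = α := h.zero_or_alpha y m hym
  omega

end Exceptional

/-! ### Numbers of collinear points for non-incident pairs -/

section CollinearCounts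

variable {K : Type*} [Field K] {V : Type*} [AddCommGroup V] [Module K V]
  {H P : Submodule K V} {π : Polarity (Set.Iic H)} {π' : Polarity (Set.Ici P)}
  [FiniteDimensional K V] {x : ProjLine K V} {l : ProjPlane K V}

omit [FiniteDimensional K V] in
theorem ncard_singleton_line {A : Submodule K V} (hA : finrank K A = 2) {s : Set (ProjLine K V)}
    (hs : ∀ y, y ∈ s ↔ y.1 = A) : s.ncard = 1 := by
  refine Set.ncard_eq_one.2 ⟨⟨A, hA⟩, ?_⟩
  ext y
  rw [hs, Set.mem_singleton_iff, Subtype.ext_iff]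

/-- Otherwise Y = X + P lies in X + ⟨v⟩, which has the same dimension, and v would be in Y. This
yields lines and planes that avoid the point P. -/
theorem not_mem_of_finrank_sup {X Y : Submodule K V} {v : V} (hXY : finrank K Y = finrank K X + 1)
    (hY : X ≤ Y) (hv : v ∉ Y) {P : Submodule K V} (hP : P ≤ Y) (hPX : ¬ P ≤ X) :
    ¬ P ≤ X ⊔ K ∙ v := by
  intro h
  have h1 : finrank K X < finrank K ↑(X ⊔ P) :=
    finrank_lt_of_le_of_not_le le_sup_left fun h' => hPX (le_sup_right.trans h')
  have h2 : X ⊔ P = Y := by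
    have := finrank_le_of_le (sup_le hY hP)
    exact eq_of_le_of_finrank (sup_le hY hP) (by omega)
  have hvX : v ∉ X := fun h' => hv (hY h')
  have h3 : Y = X ⊔ K ∙ v := by
    refine eq_of_le_of_finrank (h2 ▸ sup_le le_sup_left h) ?_
    rw [Submodule.finrank_sup_span_singleton hvX, hXY]
  exact hv (h3 ▸ Submodule.mem_sup_right (Submodule.mem_span_singleton_self v))

variable [Finite K]

/-- A line not in the plane l meets it in at most one point A, and a line of l meets x iff it passes
through A. -/
theorem LP_collinearCount (hxl : ¬ x.1 ≤ l.1) :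
    collinearCount (LP K V) x l = 0 ∨ collinearCount (LP K V) x l = Nat.card K + 1 := by
  by_cases hi : x.1 ⊓ l.1 = ⊥
  · left
    rw [collinearCount, Set.ncard_eq_zero]
    ext y
    simp only [LP_adj, Set.mem_ofPred_eq, Set.mem_empty_iff_false, iff_false]
    rintro ⟨h1, -, h2⟩
    exact h2 (le_bot_iff.1 (hi ▸ inf_le_inf_left _ h1))
  · right
    have h1 := finrank_lt_of_le_of_not_le (inf_le_left : x.1 ⊓ l.1 ≤ x.1)
      (fun h' => hxl (h'.trans inf_le_right))
    have h2 := ne_bot_iff_finrank.1 hi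
    rw [x.2] at h1
    have hd : finrank K ↑(x.1 ⊓ l.1) = 1 := by omega
    rw [collinearCount, ← ncard_between_two (A := x.1 ⊓ l.1) (B := l.1) (d := 2) inf_le_right
      (by rw [hd]) (by rw [hd, l.2])]
    congr 1
    ext y
    simp only [LP_adj, LP, Set.mem_ofPred_eq]
    constructor
    · rintro ⟨h3, -, h4⟩
      refine ⟨le_of_finrank_one hd (ne_bot_of_le_ne_bot h4 ?_), h3⟩
      exact le_inf (inf_le_inf_left _ h3) inf_le_right
    · rintro ⟨h3, h4⟩
      exact ⟨h4, fun e => hxl (e ▸ h4), ne_bot_of_le_ne_bot hi (le_inf inf_le_left h3)⟩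

theorem LP_not_hasExceptional : ¬ HasExceptional (LP K V) (Nat.card K + 1) := by
  rintro ⟨x, l, hxl, h⟩
  exact h (LP_collinearCount hxl)

namespace IsAntiflag

variable (h : IsAntiflag H P)
include h

theorem LP_isSemipartialGeometry : IsSemipartialGeometry (LP K V) (Nat.card K * (Nat.card K + 1))
    (Nat.card K * (Nat.card K + 1)) (Nat.card K + 1) ((Nat.card K + 1) ^ 2) where
  configuration := by
    have := h.isConfiguration h.LP_point_degree (fun l => ncard_lines_le l.2) LP_partial_linear
    have e : Nat.card K * (Nat.card K + 1) + 1 = Nat.card K ^ 2 + Nat.card K + 1 := by ring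
    rw [e]
    exact ⟨_, _, this⟩
  zero_or_alpha x l hxl := LP_collinearCount hxl
  mu_eq x y := LP_mu

/-- If x and l lie in H, the lines through the pole R of l that meet x are the q+1 lines through R
in the plane x + R. If l is not in H, the count is that of LP. -/
theorem hyperplaneTransform_collinearCount (hxl : ¬ hyperplaneTransform H π (LP K V) x l)
    (hxH : ¬ (¬ x.1 ≤ H ∧ l.1 ≤ H)) :
    collinearCount (hyperplaneTransform H π (LP K V)) x l = 0 ∨
      collinearCount (hyperplaneTransform H π (LP K V)) x l = Nat.card K + 1 := by
  by_cases hl : l.1 ≤ H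
  · have hx : x.1 ≤ H := by tauto
    right
    rw [hyperplaneTransform_LP_of_line_le hl] at hxl
    replace hxl : ¬ π.app l.1 ≤ x.1 := fun h' => hxl ⟨h', hx⟩
    have hd := h.finrank_app_hyperplane (π := π) hl
    rw [l.2] at hd
    replace hd : finrank K (π.app l.1) = 1 := by omega
    have hd' : finrank K ↑(x.1 ⊔ π.app l.1) = 3 := by rw [finrank_sup_of_not_le hd hxl, x.2]
    rw [collinearCount, ← ncard_between_two (A := π.app l.1) (B := x.1 ⊔ π.app l.1) (d := 2)
      le_sup_right (by rw [hd]) (by rw [hd, hd'])]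
    congr 1
    ext y
    simp only [h.hyperplaneTransform_adj, hyperplaneTransform_LP_of_line_le hl, Set.mem_ofPred_eq]
    constructor
    · rintro ⟨⟨h1, h2⟩, h3, h4⟩
      refine ⟨h1, (le_sup_of_two_points y.2 inf_le_right h1 h4 ?_ ?_).trans
        (sup_le_sup_right inf_le_left _)⟩
      · rw [ne_bot_iff_finrank, hd]
      · by_contra hne
        rw [inf_comm] at hne
        exact hxl ((le_of_finrank_one hd hne).trans inf_le_left)
    · rintro ⟨h1, h2⟩
      exact ⟨⟨h1, h2.trans (sup_le hx (π.app_mem hl))⟩, fun e => hxl (e ▸ h1),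
        ProjLine.meet_of_le ⟨_, hd'⟩ le_sup_left h2⟩
  · rw [hyperplaneTransform_LP_of_not_le_line hl] at hxl
    have e : collinearCount (hyperplaneTransform H π (LP K V)) x l =
        collinearCount (LP K V) x l := by
      simp only [collinearCount, h.pointGraph_hyperplaneTransform,
        hyperplaneTransform_LP_of_not_le_line hl, LP]
    rw [e]
    exact LP_collinearCount hxl

theorem pointTransform_collinearCount (hxl : ¬ pointTransform P π' (LP K V) x l)
    (hxP : ¬ (P ≤ x.1 ∧ ¬ P ≤ l.1)) :
    collinearCount (pointTransform P π' (LP K V)) x l = 0 ∨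
      collinearCount (pointTransform P π' (LP K V)) x l = Nat.card K + 1 := by
  by_cases hx : P ≤ x.1
  · have hl : P ≤ l.1 := by tauto
    right
    rw [pointTransform_of_le hx hl] at hxl
    have hd := h.finrank_app_point (π' := π') hl
    rw [l.2] at hd
    rw [collinearCount, ← ncard_between_two (A := P) (B := π'.app l.1) (d := 2)
      (π'.app_mem hl) (by rw [h.finrank_point]) (by rw [h.finrank_point]; omega)]
    congr 1
    ext y
    simp only [pointTransform_LP_of_le_line hl, Set.mem_ofPred_eq]
    constructor
    · rintro ⟨h1 | ⟨h1, h2⟩, h3⟩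
      · exact h1
      · rw [h.pointTransform_adj_of_le_of_not_le hx h1] at h3
        -- A neighbour y of x in l off P would give l = y + P inside π'(x), making x and l incident;
        -- so only the pencil in π'(l) counts.
        have e : y.1 ⊔ P = l.1 := eq_of_le_of_finrank (sup_le h2 hl)
          (by rw [finrank_sup_of_not_le h.finrank_point h1, y.2, l.2])
        refine (hxl ?_).elim
        rw [π'.le_app_iff hx hl, ← e]
        exact sup_le h3 (π'.app_mem hx)
    · rintro ⟨h1, h2⟩
      refine ⟨Or.inl ⟨h1, h2⟩, ?_⟩
      rw [h.pointTransform_adj_of_le hx h1]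
      rintro rfl
      exact hxl h2
  · rw [pointTransform_LP_of_not_le_point hx] at hxl
    suffices e : collinearCount (pointTransform P π' (LP K V)) x l =
        collinearCount (LP K V) x l by
      rw [e]
      exact LP_collinearCount hxl
    rw [collinearCount, collinearCount, ncard_split (fun y : ProjLine K V => P ≤ y.1),
      ncard_split (fun y : ProjLine K V => P ≤ y.1)
        (fun y => LP K V y l ∧ (pointGraph (LP K V)).Adj x y)]
    congr 1
    · by_cases hl : P ≤ l.1
      -- Lines through P in l ∩ (x+P) are replaced by those in π'(l) ∩ π'(x+P), equally many.
      · have key := h.ncard_lines_inf_app (π' := π') hl (le_sup_right : P ≤ x.1 ⊔ P) l.2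
          (by rw [finrank_sup_of_not_le h.finrank_point hx, x.2])
        convert key using 2
        · ext y
          simp only [Set.mem_ofPred_eq, le_inf_iff]
          refine and_congr_right fun hy => ?_
          rw [pointTransform_of_le hy hl, h.pointTransform_adj_iff_le_app hx hy]
        · ext y
          simp only [Set.mem_ofPred_eq, le_inf_iff]
          refine and_congr_right fun hy => ?_
          rw [h.LP_adj_iff_le_sup hx hy, LP]
      · congr 1
        ext y
        simp only [Set.mem_ofPred_eq, pointTransform_LP_of_not_le_line hl]
        exact ⟨fun h' => (hl (h'.1.trans h'.2.1)).elim, fun h' => (hl (h'.1.trans h'.2.1)).elim⟩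
    · congr 1
      ext y
      simp only [Set.mem_ofPred_eq]
      refine and_congr_right fun hy => ?_
      rw [pointTransform_LP_of_not_le_point hy, pointTransform_adj_of_not_le hx hy, LP_adj, LP]

open Classical in
-- The line x meets H in a single point. If this is the pole of l, every line of H through the pole
-- meets x; otherwise only the join of the two points does.
theorem ncard_lines_meeting_in_hyperplane (hx : ¬ x.1 ≤ H) (hl : l.1 ≤ H) :
    {y : ProjLine K V | (π.app l.1 ≤ y.1 ∧ y.1 ≤ H) ∧ x ≠ y ∧ x.1 ⊓ y.1 ≠ ⊥}.ncard =
      if π.app l.1 ≤ x.1 then Nat.card K ^ 2 + Nat.card K + 1 else 1 := by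
  have hd := h.finrank_app_hyperplane (π := π) hl
  rw [l.2] at hd
  replace hd : finrank K (π.app l.1) = 1 := by omega
  split_ifs with hlx
  · rw [← ncard_between_three (A := π.app l.1) (B := H) (d := 2) (π.app_mem hl) (by rw [hd])
      (by rw [hd, h.finrank_hyperplane])]
    congr 1
    ext y
    simp only [Set.mem_ofPred_eq]
    refine and_iff_left_of_imp ?_
    rintro ⟨h1, h2⟩
    refine ⟨fun e => hx (e ▸ h2), ?_⟩
    rw [ne_bot_iff_finrank, ← hd]
    exact finrank_le_of_le (le_inf hlx h1)
  · have hi : finrank K ↑(x.1 ⊓ H) = 1 := h.finrank_inf_hyperplane x.2 hx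
    have hli : ¬ π.app l.1 ≤ x.1 ⊓ H := fun h' => hlx (h'.trans inf_le_left)
    have hs : finrank K ↑(x.1 ⊓ H ⊔ π.app l.1) = 2 := by rw [finrank_sup_of_not_le hd hli, hi]
    refine ncard_singleton_line hs fun y => ?_
    constructor
    · rintro ⟨⟨h1, h2⟩, h3, h4⟩
      refine (eq_of_le_of_finrank (sup_le (le_of_finrank_one hi ?_) h1) (by rw [hs, y.2])).symm
      exact ne_bot_of_le_ne_bot h4 (le_inf (inf_le_inf_left _ h2) inf_le_right)
    · intro e
      have hyH : y.1 ≤ H := e ▸ sup_le inf_le_right (π.app_mem hl)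
      refine ⟨⟨e ▸ le_sup_right, hyH⟩, fun e' => hx (e' ▸ hyH), ?_⟩
      rw [ne_bot_iff_finrank, ← hi]
      exact finrank_le_of_le (le_inf inf_le_left (e ▸ le_sup_left))

open Classical in
-- The neighbours of x in l are the lines of l inside the solid π'(x), which contains l or cuts it
-- in a line.
theorem ncard_lines_le_app (hx : P ≤ x.1) (hl : ¬ P ≤ l.1) :
    {y : ProjLine K V | y.1 ≤ l.1 ∧ (pointGraph (pointTransform P π' (LP K V))).Adj x y}.ncard =
      if l.1 ≤ π'.app x.1 then Nat.card K ^ 2 + Nat.card K + 1 else 1 := by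
  have e : {y : ProjLine K V | y.1 ≤ l.1 ∧ (pointGraph (pointTransform P π' (LP K V))).Adj x y} =
      {y | y.1 ≤ l.1 ⊓ π'.app x.1} := by
    ext y
    simp only [Set.mem_ofPred_eq, le_inf_iff]
    refine and_congr_right fun hy => ?_
    rw [h.pointTransform_adj_of_le_of_not_le hx (fun h' => hl (h'.trans hy))]
  have hd := h.finrank_app_point (π' := π') hx
  rw [x.2] at hd
  rw [e]
  split_ifs with hlx
  · rw [inf_eq_left.2 hlx, ncard_lines_le l.2]
  · have hi : finrank K ↑(l.1 ⊓ π'.app x.1) = 2 :=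
      finrank_inf_of_not_le (by rw [h.finrank_space]; omega) l.2 hlx
    exact ncard_singleton_line hi fun y => ⟨fun hy => eq_of_le_of_finrank hy (by rw [hi, y.2]),
      fun hy => hy.le⟩

open Classical in
theorem hyperplaneTransform_collinearCount_of_line_le (hx : ¬ x.1 ≤ H) (hl : l.1 ≤ H) :
    collinearCount (hyperplaneTransform H π (LP K V)) x l =
      if π.app l.1 ≤ x.1 then Nat.card K ^ 2 + Nat.card K + 1 else 1 := by
  simp only [collinearCount, h.hyperplaneTransform_adj, hyperplaneTransform_LP_of_line_le hl,
    h.ncard_lines_meeting_in_hyperplane hx hl]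

open Classical in
-- The lines counted lie in H and so miss P, as x does; their adjacency to x is therefore unaffected
-- by π'.
theorem both_transforms_collinearCount_of_line_le (hx : ¬ x.1 ≤ H) (hxP : ¬ P ≤ x.1)
    (hl : l.1 ≤ H) :
    collinearCount (pointTransform P π' (hyperplaneTransform H π (LP K V))) x l =
      if π.app l.1 ≤ x.1 then Nat.card K ^ 2 + Nat.card K + 1 else 1 := by
  rw [← h.ncard_lines_meeting_in_hyperplane hx hl, collinearCount]
  congr 1
  ext y
  have hPl : ¬ P ≤ l.1 := fun h' => h.not_le (h'.trans hl)
  simp only [Set.mem_ofPred_eq, both_transforms_of_not_le_line hPl,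
    hyperplaneTransform_LP_of_line_le hl]
  refine and_congr_right fun hy => ?_
  rw [h.pointGraph_both_transforms,
    pointTransform_adj_of_not_le hxP (fun h' => h.not_le (h'.trans hy.2))]

open Classical in
theorem pointTransform_collinearCount_of_point_le (hx : P ≤ x.1) (hl : ¬ P ≤ l.1) :
    collinearCount (pointTransform P π' (LP K V)) x l =
      if l.1 ≤ π'.app x.1 then Nat.card K ^ 2 + Nat.card K + 1 else 1 := by
  simp only [collinearCount, pointTransform_LP_of_not_le_line hl, h.ncard_lines_le_app hx hl]

open Classical in
theorem both_transforms_collinearCount_of_point_le (hx : P ≤ x.1) (hl : ¬ P ≤ l.1)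
    (hlH : ¬ l.1 ≤ H) :
    collinearCount (pointTransform P π' (hyperplaneTransform H π (LP K V))) x l =
      if l.1 ≤ π'.app x.1 then Nat.card K ^ 2 + Nat.card K + 1 else 1 := by
  simp only [collinearCount, both_transforms_of_not_le_line hl, h.pointGraph_both_transforms,
    hyperplaneTransform_LP_of_not_le_line hlH, h.ncard_lines_le_app hx hl]

/-! ### Lines and planes in special position -/

omit [Finite K] in
theorem exists_line_not_le :
    ∃ x : ProjLine K V, ¬ x.1 ≤ H ∧ ¬ P ≤ x.1 := by
  obtain ⟨R, -, hR, hd⟩ := exists_between_finrank (bot_le : ⊥ ≤ H) (n := 1) (by simp)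
    (by rw [h.finrank_hyperplane]; omega)
  have hPR : ¬ P ≤ R := fun h' => h.not_le (h'.trans hR)
  have hRP : finrank K ↑(R ⊔ P) = 2 := by rw [finrank_sup_of_not_le h.finrank_point hPR, hd]
  -- With R a point of H, the line R + ⟨v⟩ leaves H because v does, and misses P because v is not on
  -- the line RP.
  obtain ⟨v, hv1, hv2⟩ := exists_notMem_of_ne_top (X := H) (Y := R ⊔ P)
    (ne_top_of_finrank_lt (by rw [h.finrank_hyperplane, h.finrank_space]; omega))
    (ne_top_of_finrank_lt (by rw [hRP, h.finrank_space]; omega))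
  have hvR : v ∉ R := fun h' => hv1 (hR h')
  refine ⟨⟨R ⊔ K ∙ v, by rw [Submodule.finrank_sup_span_singleton hvR, hd]⟩, fun h' => ?_, ?_⟩
  · exact hv1 (h' (Submodule.mem_sup_right (Submodule.mem_span_singleton_self v)))
  · exact not_mem_of_finrank_sup (by rw [hRP, hd]) le_sup_left hv2 le_sup_right hPR

omit [Finite K] in
theorem exists_plane_of_line (hxP : ¬ P ≤ x.1) : ∃ l : ProjPlane K V, x.1 ≤ l.1 ∧ ¬ P ≤ l.1 := by
  have hd : finrank K ↑(x.1 ⊔ P) = 3 := by rw [finrank_sup_of_not_le h.finrank_point hxP, x.2]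
  have hne : x.1 ⊔ P ≠ ⊤ := ne_top_of_finrank_lt (by rw [hd, h.finrank_space]; omega)
  obtain ⟨v, hv, -⟩ := exists_notMem_of_ne_top hne hne
  have hvx : v ∉ x.1 := fun h' => hv (Submodule.mem_sup_left h')
  exact ⟨⟨x.1 ⊔ K ∙ v, by rw [Submodule.finrank_sup_span_singleton hvx, x.2]⟩, le_sup_left,
    not_mem_of_finrank_sup (by rw [hd, x.2]) le_sup_left hv le_sup_right hxP⟩

omit [Finite K] in
theorem exists_skew_line (x : ProjLine K V) :
    ∃ y : ProjLine K V, ¬ y.1 ≤ H ∧ x.1 ⊓ y.1 = ⊥ := by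
  -- The line vw leaves H because of v; choosing w outside x + ⟨v⟩ makes its join with x
  -- four-dimensional, so it is skew to x.
  obtain ⟨v, hv1, hv2⟩ := exists_notMem_of_ne_top (X := H) (Y := x.1)
    (ne_top_of_finrank_lt (by rw [h.finrank_hyperplane, h.finrank_space]; omega))
    (ne_top_of_finrank_lt (by rw [x.2, h.finrank_space]; omega))
  have h3 : finrank K ↑(x.1 ⊔ K ∙ v) = 3 := by
    rw [Submodule.finrank_sup_span_singleton hv2, x.2]
  have hne : x.1 ⊔ K ∙ v ≠ ⊤ := ne_top_of_finrank_lt (by rw [h3, h.finrank_space]; omega)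
  obtain ⟨w, hw, -⟩ := exists_notMem_of_ne_top hne hne
  have hwv : w ∉ K ∙ v := fun h' => hw (Submodule.mem_sup_right h')
  have hv0 : v ≠ 0 := fun e => hv2 (e ▸ Submodule.zero_mem _)
  have h4 : finrank K ↑((K ∙ v) ⊔ K ∙ w) = 2 := by
    rw [Submodule.finrank_sup_span_singleton hwv, finrank_span_singleton hv0]
  refine ⟨⟨_, h4⟩, fun h' => ?_, ?_⟩
  · exact hv1 (h' (Submodule.mem_sup_left (Submodule.mem_span_singleton_self v)))
  · have h5 := ProjLine.finrank_sup_add_inf x ⟨_, h4⟩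
    rw [show x.1 ⊔ (⟨_, h4⟩ : ProjLine K V).1 = x.1 ⊔ K ∙ v ⊔ K ∙ w from (sup_assoc _ _ _).symm,
      Submodule.finrank_sup_span_singleton hw, h3] at h5
    exact Submodule.finrank_eq_zero.1 (by omega)

omit [Finite K] in
variable (π) in
/-- For a line outside `H` there are planes of `H` whose pole is on the line, and others. -/
theorem exists_plane_pole (hx : ¬ x.1 ≤ H) :
    (∃ l : ProjPlane K V, l.1 ≤ H ∧ π.app l.1 ≤ x.1) ∧
      ∃ l : ProjPlane K V, l.1 ≤ H ∧ ¬ π.app l.1 ≤ x.1 := by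
  -- Every point of H is a pole, so it suffices to choose the pole: x ∩ H, or a point of H off x.
  have key : ∀ A ≤ H, finrank K A = 1 → ∃ l : ProjPlane K V, l.1 ≤ H ∧ π.app l.1 = A := by
    intro A hA hd
    have h1 := h.finrank_app_hyperplane (π := π) hA
    exact ⟨⟨π.app A, by omega⟩, π.app_mem hA, π.app_app hA⟩
  constructor
  · obtain ⟨l, h1, h2⟩ := key (x.1 ⊓ H) inf_le_right (h.finrank_inf_hyperplane x.2 hx)
    exact ⟨l, h1, h2.trans_le inf_le_left⟩
  · obtain ⟨v, hv, hvx⟩ : ∃ v ∈ H, v ∉ x.1 := by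
      by_contra! h'
      have h1 := finrank_le_of_le (show H ≤ x.1 from h')
      rw [h.finrank_hyperplane, x.2] at h1
      omega
    have hv0 : v ≠ 0 := fun e => hvx (e ▸ Submodule.zero_mem _)
    obtain ⟨l, h1, h2⟩ := key (K ∙ v) (by simpa [Submodule.span_singleton_le_iff_mem] using hv)
      (finrank_span_singleton hv0)
    exact ⟨l, h1, by rwa [h2, Submodule.span_singleton_le_iff_mem]⟩

omit [Finite K] in
variable (π') in
theorem exists_plane_le_app (hx : P ≤ x.1) :
    (∃ l : ProjPlane K V, ¬ P ≤ l.1 ∧ l.1 ≤ π'.app x.1) ∧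
      ∃ l : ProjPlane K V, ¬ P ≤ l.1 ∧ ¬ l.1 ≤ π'.app x.1 := by
  have hd := h.finrank_app_point (π' := π') hx
  rw [x.2] at hd
  have hP : P ≤ π'.app x.1 := π'.app_mem hx
  constructor
  · refine ⟨⟨π'.app x.1 ⊓ H, ?_⟩, fun h' => h.not_le (h'.trans inf_le_right), inf_le_left⟩
    exact h.finrank_inf_hyperplane (by omega) (fun h' => h.not_le (hP.trans h'))
  -- The solids H and π'(x) differ, as P lies only in the second; a plane of H through a vector
  -- outside π'(x) serves.
  · obtain ⟨v, hv, hvx⟩ : ∃ v ∈ H, v ∉ π'.app x.1 := by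
      by_contra! h'
      refine h.not_le (hP.trans_eq (eq_of_le_of_finrank (show H ≤ _ from h') ?_).symm)
      rw [h.finrank_hyperplane]
      omega
    have hv0 : v ≠ 0 := fun e => hvx (e ▸ Submodule.zero_mem _)
    obtain ⟨l, h1, h2, h3⟩ := exists_between_finrank (A := K ∙ v) (B := H) (n := 3)
      (by simpa [Submodule.span_singleton_le_iff_mem] using hv)
      (by rw [finrank_span_singleton hv0]; omega) (by rw [h.finrank_hyperplane]; omega)
    refine ⟨⟨l, h3⟩, fun h' => h.not_le (h'.trans h2), fun h' => hvx (h' ?_)⟩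
    exact h1 (Submodule.mem_span_singleton_self v)

/-! ### Exceptional pairs of the transformed structures -/

omit h in
theorem _root_.SRConf.one_ne_sq_add : 1 ≠ Nat.card K ^ 2 + Nat.card K + 1 := by
  have : 0 < Nat.card K := Nat.card_pos
  omega

omit h in
omit [FiniteDimensional K V] in
theorem _root_.SRConf.isExceptional_of_count {I : ProjLine K V → ProjPlane K V → Prop}
    (hxl : ¬ I x l) {p : Prop} [Decidable p]
    (hc : collinearCount I x l = if p then Nat.card K ^ 2 + Nat.card K + 1 else 1) :
    IsExceptional I (Nat.card K + 1) x l := by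
  refine ⟨hxl, ?_⟩
  have h1 : 0 < Nat.card K := Nat.card_pos
  have h2 : 0 < Nat.card K ^ 2 := by positivity
  by_cases hp : p
  · rw [if_pos hp] at hc
    omega
  · rw [if_neg hp] at hc
    omega

theorem hyperplaneTransform_isExceptional (hx : ¬ x.1 ≤ H) (hl : l.1 ≤ H) :
    IsExceptional (hyperplaneTransform H π (LP K V)) (Nat.card K + 1) x l := by
  classical
  refine isExceptional_of_count ?_ (h.hyperplaneTransform_collinearCount_of_line_le hx hl)
  rw [hyperplaneTransform_LP_of_line_le hl]
  exact fun h' => hx h'.2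

theorem pointTransform_isExceptional (hx : P ≤ x.1) (hl : ¬ P ≤ l.1) :
    IsExceptional (pointTransform P π' (LP K V)) (Nat.card K + 1) x l := by
  classical
  refine isExceptional_of_count ?_ (h.pointTransform_collinearCount_of_point_le hx hl)
  rw [pointTransform_LP_of_not_le_line hl]
  exact fun h' => hl (hx.trans h')

omit [FiniteDimensional K V] [Finite K] h in
theorem _root_.SRConf.both_transforms_not_incident (hx : ¬ x.1 ≤ H) (hxP : ¬ P ≤ x.1) (hl : l.1 ≤ H) :
    ¬ pointTransform P π' (hyperplaneTransform H π (LP K V)) x l := by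
  rw [both_transforms_of_not_le_point hxP, hyperplaneTransform_LP_of_line_le hl]
  exact fun h' => hx h'.2

theorem both_transforms_isExceptional (hx : ¬ x.1 ≤ H) (hxP : ¬ P ≤ x.1) (hl : l.1 ≤ H) :
    IsExceptional (pointTransform P π' (hyperplaneTransform H π (LP K V))) (Nat.card K + 1)
      x l := by
  classical
  exact isExceptional_of_count (both_transforms_not_incident hx hxP hl)
    (h.both_transforms_collinearCount_of_line_le hx hxP hl)

theorem both_transforms_isExceptional_of_point_le (hx : P ≤ x.1) (hl : ¬ P ≤ l.1)
    (hlH : ¬ l.1 ≤ H) :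
    IsExceptional (pointTransform P π' (hyperplaneTransform H π (LP K V))) (Nat.card K + 1)
      x l := by
  classical
  refine isExceptional_of_count ?_ (h.both_transforms_collinearCount_of_point_le hx hl hlH)
  rw [both_transforms_of_not_le_line hl, hyperplaneTransform_LP_of_not_le_line hlH]
  exact fun h' => hl (hx.trans h')

theorem hyperplaneTransform_of_isExceptional
    (he : IsExceptional (hyperplaneTransform H π (LP K V)) (Nat.card K + 1) x l) :
    ¬ x.1 ≤ H ∧ l.1 ≤ H := by
  by_contra h'
  exact he.2 (h.hyperplaneTransform_collinearCount he.1 h')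

theorem pointTransform_of_isExceptional
    (he : IsExceptional (pointTransform P π' (LP K V)) (Nat.card K + 1) x l) :
    P ≤ x.1 ∧ ¬ P ≤ l.1 := by
  by_contra h'
  exact he.2 (h.pointTransform_collinearCount he.1 h')

omit [Finite K] in
theorem exists_line_through : ∃ x : ProjLine K V, P ≤ x.1 := by
  obtain ⟨X, h1, -, h2⟩ := exists_between_finrank (le_top : P ≤ ⊤) (n := 2)
    (by rw [h.finrank_point]; omega) (by rw [finrank_top, h.finrank_space]; omega)
  exact ⟨⟨X, h2⟩, h1⟩

/-- Two skew lines outside H are each exceptional with any plane of H. -/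
theorem hyperplaneTransform_hasNonCollinearExceptional :
    HasNonCollinearExceptional (hyperplaneTransform H π (LP K V)) (Nat.card K + 1) := by
  obtain ⟨x, hx, -⟩ := h.exists_line_not_le
  obtain ⟨y, hy, hxy⟩ := h.exists_skew_line x
  obtain ⟨⟨l, hl, -⟩, -⟩ := h.exists_plane_pole π hx
  refine ⟨x, l, y, l, ?_, ?_, h.hyperplaneTransform_isExceptional hx hl,
    h.hyperplaneTransform_isExceptional hy hl⟩
  · rintro rfl
    rw [inf_idem] at hxy
    exact hx (hxy ▸ bot_le)
  · rw [h.hyperplaneTransform_adj]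
    exact fun h' => h'.2 hxy

theorem hyperplaneTransform_not_hasIncidentExceptional :
    ¬ HasIncidentExceptional (hyperplaneTransform H π (LP K V)) (Nat.card K + 1) := by
  rintro ⟨x, l, y, m, h1, h2, h3⟩
  rw [hyperplaneTransform_LP_of_line_le (h.hyperplaneTransform_of_isExceptional h3).2] at h1
  exact (h.hyperplaneTransform_of_isExceptional h2).1 h1.2

/-- Exceptional points are lines through P, and these are pairwise collinear. -/
theorem pointTransform_not_hasNonCollinearExceptional :
    ¬ HasNonCollinearExceptional (pointTransform P π' (LP K V)) (Nat.card K + 1) := by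
  rintro ⟨x, l, y, m, h1, h2, h3, h4⟩
  exact h2 ((h.pointTransform_adj_of_le (h.pointTransform_of_isExceptional h3).1
    (h.pointTransform_of_isExceptional h4).1).2 h1)

theorem pointTransform_not_hasIncidentExceptional :
    ¬ HasIncidentExceptional (pointTransform P π' (LP K V)) (Nat.card K + 1) := by
  rintro ⟨x, l, y, m, h1, h2, h3⟩
  have hl := (h.pointTransform_of_isExceptional h3).2
  rw [pointTransform_LP_of_not_le_line hl] at h1
  exact hl ((h.pointTransform_of_isExceptional h2).1.trans h1)

theorem pointTransform_hasExceptional :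
    HasExceptional (pointTransform P π' (LP K V)) (Nat.card K + 1) := by
  obtain ⟨x, hx⟩ := h.exists_line_through
  obtain ⟨⟨l, hl, -⟩, -⟩ := h.exists_plane_le_app π' hx
  exact ⟨x, l, h.pointTransform_isExceptional hx hl⟩

/-- A line x outside H and off P is exceptional with planes of H. A plane on x missing P is not in
H, is still incident with x, and is exceptional with lines through P. -/
theorem both_transforms_hasIncidentExceptional :
    HasIncidentExceptional (pointTransform P π' (hyperplaneTransform H π (LP K V)))
      (Nat.card K + 1) := by
  obtain ⟨x, hx, hxP⟩ := h.exists_line_not_le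
  obtain ⟨l, hxl, hlP⟩ := h.exists_plane_of_line hxP
  obtain ⟨⟨m, hm, -⟩, -⟩ := h.exists_plane_pole π hx
  obtain ⟨y, hy⟩ := h.exists_line_through
  refine ⟨x, l, y, m, ?_, h.both_transforms_isExceptional hx hxP hm,
    h.both_transforms_isExceptional_of_point_le hy hlP (fun h' => hx (hxl.trans h'))⟩
  rwa [both_transforms_of_not_le_point hxP, hyperplaneTransform_LP_of_not_le_point hx]

/-- A single line outside H already sees both counts, 1 and q^2+q+1, according to whether the pole
of the plane is on it; α cannot equal both. -/
theorem hyperplaneTransform_not_isSemipartialGeometry (s t α μ : ℕ) :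
    ¬ IsSemipartialGeometry (hyperplaneTransform H π (LP K V)) s t α μ := by
  classical
  obtain ⟨x, hx, -⟩ := h.exists_line_not_le
  obtain ⟨⟨l, hl, hlx⟩, m, hm, hmx⟩ := h.exists_plane_pole π hx
  refine not_isSemipartialGeometry one_ne_zero (Nat.succ_ne_zero _) (one_ne_sq_add (K := K))
    ⟨x, m, (h.hyperplaneTransform_isExceptional hx hm).1, ?_⟩
    ⟨x, l, (h.hyperplaneTransform_isExceptional hx hl).1, ?_⟩ s t α μ
  · rw [h.hyperplaneTransform_collinearCount_of_line_le hx hm, if_neg hmx]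
  · rw [h.hyperplaneTransform_collinearCount_of_line_le hx hl, if_pos hlx]

theorem pointTransform_not_isSemipartialGeometry (s t α μ : ℕ) :
    ¬ IsSemipartialGeometry (pointTransform P π' (LP K V)) s t α μ := by
  classical
  obtain ⟨x, hx⟩ := h.exists_line_through
  obtain ⟨⟨l, hl, hlx⟩, m, hm, hmx⟩ := h.exists_plane_le_app π' hx
  refine not_isSemipartialGeometry one_ne_zero (Nat.succ_ne_zero _) (one_ne_sq_add (K := K))
    ⟨x, m, (h.pointTransform_isExceptional hx hm).1, ?_⟩
    ⟨x, l, (h.pointTransform_isExceptional hx hl).1, ?_⟩ s t α μ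
  · rw [h.pointTransform_collinearCount_of_point_le hx hm, if_neg hmx]
  · rw [h.pointTransform_collinearCount_of_point_le hx hl, if_pos hlx]

theorem both_transforms_not_isSemipartialGeometry (s t α μ : ℕ) :
    ¬ IsSemipartialGeometry (pointTransform P π' (hyperplaneTransform H π (LP K V))) s t α μ := by
  classical
  obtain ⟨x, hx, hxP⟩ := h.exists_line_not_le
  obtain ⟨⟨l, hl, hlx⟩, m, hm, hmx⟩ := h.exists_plane_pole π hx
  refine not_isSemipartialGeometry one_ne_zero (Nat.succ_ne_zero _) (one_ne_sq_add (K := K))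
    ⟨x, m, both_transforms_not_incident hx hxP hm, ?_⟩
    ⟨x, l, both_transforms_not_incident hx hxP hl, ?_⟩ s t α μ
  · rw [h.both_transforms_collinearCount_of_line_le hx hxP hm, if_neg hmx]
  · rw [h.both_transforms_collinearCount_of_line_le hx hxP hl, if_pos hlx]

theorem not_isSemipartialGeometry_fourStructures {i : Fin 4} (hi : i ≠ 0) (s t α μ : ℕ) :
    ¬ IsSemipartialGeometry (fourStructures H P π π' i) s t α μ := by
  fin_cases i
  · exact (hi rfl).elim
  · exact h.hyperplaneTransform_not_isSemipartialGeometry s t α μ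
  · exact h.pointTransform_not_isSemipartialGeometry s t α μ
  · exact h.both_transforms_not_isSemipartialGeometry s t α μ

theorem not_isomorphic_fourStructures {i j : Fin 4} (hij : i ≠ j) :
    ¬ Isomorphic (fourStructures H P π π' i) (fourStructures H P π π' j) := by
  have exc : ∀ i : Fin 4, i ≠ 0 →
      HasExceptional (fourStructures H P π π' i) (Nat.card K + 1) := by
    intro i hi
    fin_cases i
    · exact (hi rfl).elim
    · obtain ⟨x, l, -, -, -, -, hx, -⟩ := h.hyperplaneTransform_hasNonCollinearExceptional (π := π)
      exact ⟨x, l, hx⟩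
    · exact h.pointTransform_hasExceptional
    · obtain ⟨x, -, -, m, -, hx, -⟩ := h.both_transforms_hasIncidentExceptional (π := π) (π' := π')
      exact ⟨x, m, hx⟩
  -- Index 0 is the only one without exceptional pairs, index 3 the only one with incident
  -- exceptional elements, and non-collinear exceptional points separate 1 from 2.
  have key : ∀ i j : Fin 4, i < j →
      ¬ Isomorphic (fourStructures H P π π' i) (fourStructures H P π π' j) := by
    intro i j hij hiso
    by_cases hi : i = 0
    · subst hi
      exact LP_not_hasExceptional (HasExceptional.of_isomorphic hiso.symm (exc j hij.ne'))
    · by_cases hj : j = 3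
      · subst hj
        have h3 : HasIncidentExceptional (fourStructures H P π π' i) (Nat.card K + 1) :=
          HasIncidentExceptional.of_isomorphic hiso.symm h.both_transforms_hasIncidentExceptional
        have : i = 1 ∨ i = 2 := by omega
        rcases this with rfl | rfl
        · exact h.hyperplaneTransform_not_hasIncidentExceptional h3
        · exact h.pointTransform_not_hasIncidentExceptional h3
      · obtain rfl : i = 1 := by omega
        obtain rfl : j = 2 := by omega
        exact h.pointTransform_not_hasNonCollinearExceptional (HasNonCollinearExceptional.of_isomorphic
          hiso h.hyperplaneTransform_hasNonCollinearExceptional)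
  rcases lt_or_gt_of_ne hij with hlt | hlt
  · exact key i j hlt
  · exact fun hiso => key j i hlt hiso.symm

end IsAntiflag

end CollinearCounts

/-! ### Existence statements and the theorem -/

theorem exists_field_natCard {q : ℕ} (hq : IsPrimePow q) :
    ∃ (K : Type) (_ : Field K), Nat.card K = q := by
  obtain ⟨p, n, hp, hn, rfl⟩ := hq
  have : Fact p.Prime := ⟨hp.nat_prime⟩
  exact ⟨GaloisField p n, inferInstance, GaloisField.card p n hn.ne'⟩

theorem exists_isAntiflag {K : Type*} [Field K] {V : Type*} [AddCommGroup V] [Module K V]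
    [FiniteDimensional K V] (hV : finrank K V = 5) : ∃ H P : Submodule K V, IsAntiflag H P := by
  obtain ⟨H, -, -, hH⟩ := exists_between_finrank (le_top : (⊥ : Submodule K V) ≤ ⊤) (n := 4)
    (by simp) (by simp [hV])
  have hne : H ≠ ⊤ := ne_top_of_finrank_lt (by rw [hH, hV]; omega)
  obtain ⟨v, hv, -⟩ := exists_notMem_of_ne_top hne hne
  refine ⟨H, K ∙ v, hV, hH, finrank_span_singleton fun e => hv (e ▸ H.zero_mem), ?_⟩
  rwa [Submodule.span_singleton_le_iff_mem]

end SRConf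

theorem theorem3p3 (q : ℕ) (hq : IsPrimePow q) :
    -- there is a field with `q` elements
    (∃ (K : Type) (_ : Field K), Nat.card K = q) ∧
    ∀ (K : Type*) [Field K], Nat.card K = q →
      -- non-incident point-hyperplane pairs and polarities exist in `PG(4,q)`
      (∃ H₀ P₀ : Submodule K (Fin 5 → K),
        Module.finrank K H₀ = 4 ∧ Module.finrank K P₀ = 1 ∧ ¬ P₀ ≤ H₀) ∧
      (∀ H₀ : Submodule K (Fin 5 → K), Module.finrank K H₀ = 4 →
        Nonempty (SRConf.Polarity (Set.Iic H₀))) ∧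
      (∀ P₀ : Submodule K (Fin 5 → K), Module.finrank K P₀ = 1 →
        Nonempty (SRConf.Polarity (Set.Ici P₀))) ∧
      -- and all choices of them give four pairwise non-isomorphic configurations
      ∀ H₀ P₀ : Submodule K (Fin 5 → K),
        Module.finrank K H₀ = 4 → Module.finrank K P₀ = 1 → ¬ P₀ ≤ H₀ →
        ∀ (π : SRConf.Polarity (Set.Iic H₀)) (π' : SRConf.Polarity (Set.Ici P₀)),
          (∀ i, SRConf.IsStronglyRegularConfiguration (SRConf.fourStructures H₀ P₀ π π' i)
            ((q ^ 2 + 1) * (q ^ 4 + q ^ 3 + q ^ 2 + q + 1)) (q ^ 2 + q + 1)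
            (q ^ 3 + 2 * q ^ 2 + q - 1) ((q + 1) ^ 2)) ∧
          (∀ i j, i ≠ j → ¬ SRConf.Isomorphic (SRConf.fourStructures H₀ P₀ π π' i)
            (SRConf.fourStructures H₀ P₀ π π' j)) ∧
          SRConf.IsSemipartialGeometry (SRConf.fourStructures H₀ P₀ π π' 0)
            (q * (q + 1)) (q * (q + 1)) (q + 1) ((q + 1) ^ 2) ∧
          ∀ i, i ≠ 0 → ∀ s t α μ,
            ¬ SRConf.IsSemipartialGeometry (SRConf.fourStructures H₀ P₀ π π' i) s t α μ := by
  refine ⟨SRConf.exists_field_natCard hq, ?_⟩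
  intro K _ hK
  -- `Nat.card` is 0 on infinite types, so a nonzero value forces finiteness.
  have : Finite K := Nat.finite_of_card_ne_zero (hK ▸ hq.ne_zero)
  have hV : Module.finrank K (Fin 5 → K) = 5 := by simp
  subst hK
  refine ⟨?_, fun H _ => SRConf.nonempty_polarity_Iic H, fun P _ => SRConf.nonempty_polarity_Ici P,
    ?_⟩
  · obtain ⟨H, P, h⟩ := SRConf.exists_isAntiflag hV
    exact ⟨H, P, h.finrank_hyperplane, h.finrank_point, h.not_le⟩
  · intro H P hH hP hPH π π'
    have h : SRConf.IsAntiflag H P := ⟨hV, hH, hP, hPH⟩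
    exact ⟨h.isStronglyRegular_fourStructures, fun i j => h.not_isomorphic_fourStructures,
      h.LP_isSemipartialGeometry, fun i hi => h.not_isSemipartialGeometry_fourStructures hi⟩
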